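/- **Setting.** Let $\mathcal P=\mathcal X\sqcup\mathcal Y$, where the propositions in $\mathcal X$ are controlled by the environment and those in $\mathcal Y$ by the agent, and let $\varphi$ be an LTL$_f$ formula over $\mathcal P$ in negation normal form, i.e. built from $\mathtt{true},\mathtt{false}$, literals $p,\neg p$, $\wedge,\vee$, $\circ$ (next), $\bullet$ (weak next), $\mathsf U$, $\mathsf R$. Formulas are interpreted on finite traces $\rho\in(2^{\mathcal P})^*$, the empty trace $\epsilon$ included: $\rho,i\models\circ\psi$ iff $i+1<|\rho|$ and $\rho,i+1\models\psi$; $\rho,i\models\bullet\psi$ iff $i+1<|\rho|$ implies $\rho,i+1\models\psi$; the other connectives are as usual; on $\epsilon$, literals, $\circ$- and $\mathsf U$-formulas are false, and $\bullet$- and $\mathsf R$-formulas are true. Write $\Diamond true=\mathtt{true}\,\mathsf U\,\mathtt{true}$ and $\Box false=\mathtt{false}\,\mathsf R\,\mathtt{false}$. *Synthesis.* For $g:(2^{\mathcal X})^*\to 2^{\mathcal Y}$ and $X_0,X_1,\ldots\in 2^{\mathcal X}$ the play is $(X_0\cup g(\epsilon)),(X_1\cup g(X_0)),(X_2\cup g(X_0X_1)),\dots$.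 The function $g$ *wins* if for every sequence $X_0,X_1,\dots$ some finite prefix of the play, possibly the empty one, satisfies $\varphi$. The formula $\varphi$ is *realizable* if some $g$ wins. (If $\epsilon\not\models\varphi$, only nonempty prefixes matter.) *Normal form and progression.* $\mathsf{xnf}$ commutes with $\wedge,\vee$; $\mathsf{xnf}(\psi_1\mathsf U\psi_2)=(\mathsf{xnf}(\psi_2)\wedge\Diamond true)\vee(\mathsf{xnf}(\psi_1)\wedge\circ(\psi_1\mathsf U\psi_2))$, $\mathsf{xnf}(\psi_1\mathsf R\psi_2)=(\mathsf{xnf}(\psi_2)\vee\Box false)\wedge(\mathsf{xnf}(\psi_1)\vee\bullet(\psi_1\mathsf R\psi_2))$, and $\mathsf{xnf}$ fixes constants, literals, $\circ$-, $\bullet$-formulas, $\Diamond true$ and $\Box false$. The set $\mathsf{pa}(\psi)$ consists of the literals and temporal formulas of which $\psi$ is a positive Boolean combination, and $\psi^p$ is the positive Boolean formula obtained from $\psi$ by regarding the elements of $\mathsf{pa}(\psi)$ as variables ($p$ and $\neg p$ being two different variables); its inverse is $\phi\mapsto\phi^{\mathsf{tf}}$. $\textsc{RmNext}$ commutes with $\wedge,\vee$,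 fixes constants and maps $\Diamond true\mapsto\mathtt{true}$, $\Box false\mapsto\mathtt{false}$, $\circ\alpha\mapsto\alpha\wedge\Diamond true$, $\bullet\alpha\mapsto\alpha\vee\Box false$. For $\sigma\subseteq\mathcal P$, the progression $\mathsf{fp}(\psi,\sigma)$ commutes with $\wedge,\vee$, fixes constants, evaluates literals in $\sigma$, maps $\Diamond true,\Box false,\circ\alpha,\bullet\alpha$ as $\textsc{RmNext}$ does, and otherwise $\mathsf{fp}(\psi_1\mathsf U\psi_2,\sigma)=\mathsf{fp}(\psi_2,\sigma)\vee(\mathsf{fp}(\psi_1,\sigma)\wedge\mathsf{fp}(\circ(\psi_1\mathsf U\psi_2),\sigma))$, $\mathsf{fp}(\psi_1\mathsf R\psi_2,\sigma)=\mathsf{fp}(\psi_2,\sigma)\wedge(\mathsf{fp}(\psi_1,\sigma)\vee\mathsf{fp}(\bullet(\psi_1\mathsf R\psi_2),\sigma))$. It is extended to finite traces by iteration. *Equivalence check.* Let $\mathsf{cl}(\varphi)$ be the set of subformulas of $\varphi$, $\Diamond true$ and $\Box false$, with the constants. Fix a finite ordered list of distinct variables that contains $\mathsf{pa}(\mathsf{xnf}(\theta))$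 for every $\theta\in\mathsf{cl}(\varphi)$. Two state formulas $\psi_1,\psi_2$ are *equivalent* ($\textsc{BddBasedEqCheck}$) if the reduced ordered BDDs of $\mathsf{xnf}(\psi_1)^p$ and $\mathsf{xnf}(\psi_2)^p$ for this ordering are equal. *Node expansion* ($\textsc{DpllGetArcs}$). For an OR-node (the agent moves) with formula $\psi$, start with $\phi=\mathsf{xnf}(\psi)^p$ and $ass=\emptyset$. While $\phi$ contains agent propositions, $\textsc{GetBranchingLiteral}$ picks a literal $\ell$ over one of them, and the procedure recurses first on $(\textsc{Replace}(\phi,\ell),ass\cup\{\ell\})$, then on $(\textsc{Replace}(\phi,\neg\ell),ass\cup\{\neg\ell\})$; when $\phi$ contains none, it yields the move $ass$ with the AND-node $\phi^{\mathsf{tf}}$. For an AND-node it does the same with environment propositions, and yields $ass$ with the OR-node $\textsc{RmNext}(\phi)$. $\textsc{GetBranchingLiteral}$ and $\textsc{Replace}$ are arbitrary, subject to: $\textsc{Replace}(\phi,\ell)$ is a positive Boolean formula that contains only variables of $\phi$, contains neither $\ell$ nor $\neg\ell$, and has the same truth value as $\phi$ under every assignment that makes $\ell$ true and treats $p$ and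 $\neg p$ as complementary for every $p$. *Search.* If $\epsilon\models\varphi$, the algorithm returns the strategy that assigns to $\varphi$ the move $\mathtt{true}$ (no constraint). Otherwise it calls $\textsc{Search}(\varphi,\emptyset)$ and returns the strategy built if the result is True, and "unrealizable" if it is False. All tags, path membership and strategy entries are looked up modulo equivalence. $\textsc{Search}(\psi,path)$: 1. If $\psi$ is tagged success, return True; if it is tagged failure, return False; if it is in $path$, tag it loop and return False; if $\epsilon\models\psi$, tag it success, add $(\psi,\mathtt{true})$ to the strategy and return True. 2. For each OR-arc $(act,m)$ of $\psi$: for each AND-arc $(resp,\psi')$ of $m$, in turn, call $\textsc{Search}(\psi',[path\,|\,\psi])$, stopping at the first False. If all calls return True, tag $\psi$ success, add $(\psi,act)$ to the strategy, call $\textsc{BackProp}(\psi)$ if $\psi$ is tagged loop, and return True. 3. Tag $\psi$ failure and return False. Adding to the strategy does not overwrite an entry that is already present. $\textsc{BackProp}(\psi)$ withdraws the failure tags of the ancestors of $\psi$ in the part of the graph searched so far (they were set while $\psi$ was provisionally considered a failure); then, in repeated passes over these ancestors, it tags as success, with the corresponding strategy entry, each one that has an OR-arc all of whose AND-arcs lead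 to nodes tagged success. **Theorem.** For every $\varphi$, every such variable ordering and every such $\textsc{GetBranchingLiteral}$ and $\textsc{Replace}$, the algorithm terminates and is correct: - it answers "unrealizable" only if $\varphi$ is not realizable; - if it returns a strategy, then there is a function $g:(2^{\mathcal X})^*\to2^{\mathcal Y}$ implementing it, and every such function wins. Here $g$ *implements* the strategy if for every history $h\in(2^{\mathcal X})^*$ such that the strategy assigns a move to the progression of $\varphi$ through the play of $g$ on $h$, the set $g(h)$ makes every literal of that move true. In particular the algorithm returns a strategy if and only if $\varphi$ is realizable. If $\epsilon\not\models\varphi$, the same holds with "wins" restricted to nonempty prefixes of the play. -/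

import Mathlib

/-! ## Linear temporal logic on finite traces -/

/-- LTLf formulas in negation normal form over the set `P` of propositions. -/
inductive LTLf (P : Type*) where
  | tt : LTLf P
  | ff : LTLf P
  | pos : P → LTLf P
  | neg : P → LTLf P
  | and : LTLf P → LTLf P → LTLf P
  | or : LTLf P → LTLf P → LTLf P
  | next : LTLf P → LTLf P
  | wnext : LTLf P → LTLf P
  | unt : LTLf P → LTLf P → LTLf P
  | rel : LTLf P → LTLf P → LTLf P
  deriving DecidableEq

namespace LTLf

variable {P : Type*}

/-- `◇ true`: the trace is not empty. -/
def notEnd : LTLf P := unt tt tt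

/-- `□ false`: the trace is empty. -/
def atEnd : LTLf P := rel ff ff

/-- `holds ρ i φ` is `ρ, i ⊨ φ`. For `i = ρ.length` this is satisfaction by the empty trace: constants
keep their value, literals, next- and until-formulas are false, weak-next- and release-formulas are
true. -/
def holds (ρ : List (Set P)) : ℕ → LTLf P → Prop
  | _, tt => True
  | _, ff => False
  | i, pos p => ∃ h : i < ρ.length, p ∈ ρ[i]
  | i, neg p => ∃ h : i < ρ.length, p ∉ ρ[i]
  | i, and φ ψ => holds ρ i φ ∧ holds ρ i ψ
  | i, or φ ψ => holds ρ i φ ∨ holds ρ i ψ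
  | i, next φ => i + 1 < ρ.length ∧ holds ρ (i + 1) φ
  | i, wnext φ => i + 1 < ρ.length → holds ρ (i + 1) φ
  | i, unt φ ψ => ∃ j, i ≤ j ∧ j < ρ.length ∧ holds ρ j ψ ∧ ∀ k, i ≤ k → k < j → holds ρ k φ
  | i, rel φ ψ => ∀ j, i ≤ j → j < ρ.length → holds ρ j ψ ∨ ∃ k, i ≤ k ∧ k < j ∧ holds ρ k φ

/-- `ρ ⊨ φ`, where the finite trace `ρ` may be empty. -/
def Sat (ρ : List (Set P)) (φ : LTLf P) : Prop := holds ρ 0 φ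

/-- The procedure `IsAccepting`: evaluation of a formula on the empty trace. -/
def isAccepting : LTLf P → Bool
  | tt => true
  | ff => false
  | pos _ => false
  | neg _ => false
  | and φ ψ => isAccepting φ && isAccepting ψ
  | or φ ψ => isAccepting φ || isAccepting ψ
  | next _ => false
  | wnext _ => true
  | unt _ _ => false
  | rel _ _ => true

/-- The subformulas of a formula, together with the constants. -/
def subformulas : LTLf P → Set (LTLf P)
  | tt => {tt, ff}
  | ff => {tt, ff}
  | pos p => {pos p, tt, ff}
  | neg p => {neg p, tt, ff}
  | and φ ψ => insert (and φ ψ) (subformulas φ ∪ subformulas ψ)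
  | or φ ψ => insert (or φ ψ) (subformulas φ ∪ subformulas ψ)
  | next φ => insert (next φ) (subformulas φ)
  | wnext φ => insert (wnext φ) (subformulas φ)
  | unt φ ψ => insert (unt φ ψ) (subformulas φ ∪ subformulas ψ)
  | rel φ ψ => insert (rel φ ψ) (subformulas φ ∪ subformulas ψ)

/-- The closure `cl φ`, enriched with the subformulas of `◇ true` and `□ false`. -/
def cl (φ : LTLf P) : Set (LTLf P) :=
  subformulas φ ∪ subformulas notEnd ∪ subformulas atEnd

/-- The propositional atoms `pa φ`: the literals and temporal formulas of which `φ` is a positive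
Boolean combination. -/
def pa : LTLf P → Set (LTLf P)
  | tt => ∅
  | ff => ∅
  | and φ ψ => pa φ ∪ pa ψ
  | or φ ψ => pa φ ∪ pa ψ
  | φ => {φ}

/-- Transformation into next normal form. -/
def xnf : LTLf P → LTLf P
  | and φ ψ => and (xnf φ) (xnf ψ)
  | or φ ψ => or (xnf φ) (xnf ψ)
  | unt tt tt => notEnd
  | rel ff ff => atEnd
  | unt φ ψ => or (and (xnf ψ) notEnd) (and (xnf φ) (next (unt φ ψ)))
  | rel φ ψ => and (or (xnf ψ) atEnd) (or (xnf φ) (wnext (rel φ ψ)))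
  | φ => φ

open Classical in
/-- Formula progression through a single instant. -/
noncomputable def fp (σ : Set P) : LTLf P → LTLf P
  | tt => tt
  | ff => ff
  | pos p => if p ∈ σ then tt else ff
  | neg p => if p ∉ σ then tt else ff
  | and φ ψ => and (fp σ φ) (fp σ ψ)
  | or φ ψ => or (fp σ φ) (fp σ ψ)
  | next φ => and φ notEnd
  | wnext φ => or φ atEnd
  | unt tt tt => tt
  | rel ff ff => ff
  | unt φ ψ => or (fp σ ψ) (and (fp σ φ) (and (unt φ ψ) notEnd))
  | rel φ ψ => and (fp σ ψ) (or (fp σ φ) (or (rel φ ψ) atEnd))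

/-- Formula progression through a finite trace. -/
noncomputable def fpTrace (φ : LTLf P) (ρ : List (Set P)) : LTLf P :=
  ρ.foldl (fun ψ σ => fp σ ψ) φ

end LTLf

/-! ## Positive Boolean formulas and propositionalization -/

/-- Positive Boolean formulas over the set `A` of variables. -/
inductive PBool (A : Type*) where
  | tt : PBool A
  | ff : PBool A
  | var : A → PBool A
  | and : PBool A → PBool A → PBool A
  | or : PBool A → PBool A → PBool A

namespace PBool

variable {A : Type*}

/-- Truth under the assignment that makes exactly the variables in `C` true. -/
def Holds (C : Set A) : PBool A → Prop
  | tt => True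
  | ff => False
  | var a => a ∈ C
  | and f g => Holds C f ∧ Holds C g
  | or f g => Holds C f ∨ Holds C g

/-- The variables that occur in a formula. -/
def vars : PBool A → Set A
  | tt => ∅
  | ff => ∅
  | var a => {a}
  | and f g => vars f ∪ vars g
  | or f g => vars f ∪ vars g

/-- Substitution of the truth value `b` for the variable `a`. -/
def assign [DecidableEq A] (a : A) (b : Bool) : PBool A → PBool A
  | tt => tt
  | ff => ff
  | var c => if c = a then (if b then tt else ff) else var c
  | and f g => and (assign a b f) (assign a b g)
  | or f g => or (assign a b f) (assign a b g)

/-- Truth under the assignment that makes every variable false. -/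
def evalFalse : PBool A → Bool
  | tt => true
  | ff => false
  | var _ => false
  | and f g => evalFalse f && evalFalse g
  | or f g => evalFalse f || evalFalse g

end PBool

namespace LTLf

variable {P : Type*}

/-- Propositionalization: every literal and every temporal formula in `pa φ` becomes a variable. -/
def propositionalize : LTLf P → PBool (LTLf P)
  | tt => .tt
  | ff => .ff
  | and φ ψ => .and (propositionalize φ) (propositionalize ψ)
  | or φ ψ => .or (propositionalize φ) (propositionalize ψ)
  | φ => .var φ

end LTLf

namespace PBool

variable {P : Type*}

/-- The inverse operation of propositionalization. -/
def toFormula : PBool (LTLf P) → LTLf P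
  | tt => .tt
  | ff => .ff
  | var φ => φ
  | and f g => .and (toFormula f) (toFormula g)
  | or f g => .or (toFormula f) (toFormula g)

/-- The function `RmNext`. It is only called on formulas without literals and without until- and
release-formulas other than `◇ true` and `□ false`; the last clause is there for totality. -/
def rmNext : PBool (LTLf P) → LTLf P
  | tt => .tt
  | ff => .ff
  | and f g => .and (rmNext f) (rmNext g)
  | or f g => .or (rmNext f) (rmNext g)
  | var (.unt .tt .tt) => .tt
  | var (.rel .ff .ff) => .ff
  | var (.next φ) => .and φ .notEnd
  | var (.wnext φ) => .or φ .atEnd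
  | var φ => φ

/-- The propositions of `P` of which a literal occurs in a propositionalized formula. -/
def props [DecidableEq P] : PBool (LTLf P) → Finset P
  | tt => ∅
  | ff => ∅
  | and f g => props f ∪ props g
  | or f g => props f ∪ props g
  | var (.pos p) => {p}
  | var (.neg p) => {p}
  | var _ => ∅

end PBool

/-! ## Reduced ordered binary decision diagrams -/

/-- Binary decision diagrams with decision variables in `A`. -/
inductive BDD (A : Type*) where
  | leaf : Bool → BDD A
  | node : A → BDD A → BDD A → BDD A
  deriving DecidableEq

/-- The reduced ordered BDD of a formula with respect to the variable ordering `ord`, by Shannon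
expansion; a decision node with two equal children is replaced by its child. -/
def bddRepresentation {A : Type*} [DecidableEq A] : List A → PBool A → BDD A
  | [], f => .leaf f.evalFalse
  | a :: ord, f =>
    let lo := bddRepresentation ord (f.assign a false)
    let hi := bddRepresentation ord (f.assign a true)
    if lo = hi then lo else .node a lo hi

/-- The BDD variables of the problem with specification `φ`: all atoms of the next normal forms of
the formulas in `cl φ`. -/
def bddVars {P : Type*} (φ : LTLf P) : Set (LTLf P) :=
  ⋃ θ ∈ φ.cl, (LTLf.xnf θ).pa

/-- The procedure `BddBasedEqCheck`: equality of the BDDs of the propositionalized next normal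
forms of two state formulas. -/
def bddBasedEqCheck {P : Type*} [DecidableEq P] (ord : List (LTLf P)) (ψ₁ ψ₂ : LTLf P) : Bool :=
  bddRepresentation ord ψ₁.xnf.propositionalize = bddRepresentation ord ψ₂.xnf.propositionalize

/-! ## DPLL-based expansion of search nodes -/

/-- A literal: a proposition and the truth value that it is given. -/
abbrev Literal (P : Type*) := P × Bool

/-- A move: a set of literals; propositions that are not mentioned are don't cares. -/
abbrev Move (P : Type*) := Finset (Literal P)

/-- The literal `ℓ` is true in the interpretation `σ`. -/
def Literal.True {P : Type*} (σ : Set P) (ℓ : Literal P) : Prop := ℓ.2 = true ↔ ℓ.1 ∈ σ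

/-- The search nodes: OR-nodes (the agent moves) and AND-nodes (the environment moves), each with
its formula. -/
inductive Node (P : Type*) where
  | orNode : LTLf P → Node P
  | andNode : LTLf P → Node P

/-- The formula of a search node. -/
def Node.formula {P : Type*} : Node P → LTLf P
  | .orNode ψ => ψ
  | .andNode ψ => ψ

/-- The assignment `C` of the atoms treats the two literals of each proposition as complementary. -/
def Complementary {P : Type*} (C : Set (LTLf P)) : Prop :=
  ∀ p : P, LTLf.neg p ∈ C ↔ LTLf.pos p ∉ C

/-- A realization of the two subprocedures that the DPLL-based expansion leaves open:
`branchingLiteral` (`GetBranchingLiteral`) selects a literal over one of the candidate propositions,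
and `replace` (`Replace`) gives a literal the value true and simplifies, so that the result agrees
with the input wherever that literal is true, does not mention the proposition of the literal, and
contains no new atoms. -/
structure DpllRealization (P : Type*) where
  branchingLiteral : (V : Finset P) → PBool (LTLf P) → V.Nonempty → Literal P
  replace : PBool (LTLf P) → Literal P → PBool (LTLf P)
  branchingLiteral_mem : ∀ (V : Finset P) (f : PBool (LTLf P)) (hV : V.Nonempty),
    (branchingLiteral V f hV).1 ∈ V
  replace_holds : ∀ (f : PBool (LTLf P)) (ℓ : Literal P) (C : Set (LTLf P)), Complementary C →
    (ℓ.2 = true ↔ LTLf.pos ℓ.1 ∈ C) → (PBool.Holds C (replace f ℓ) ↔ PBool.Holds C f)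
  replace_vars : ∀ (f : PBool (LTLf P)) (ℓ : Literal P),
    (replace f ℓ).vars ⊆ f.vars \ {LTLf.pos ℓ.1, LTLf.neg ℓ.1}

section Dpll

/-! The propositions are `X ⊕ Y`: the elements of `X` are controlled by the environment, those of `Y`
by the agent. A generator is represented by the sequence of the values that it yields; the result
`none` in `Option` stands for a computation that does not terminate. -/

variable {X Y : Type*} [DecidableEq X] [DecidableEq Y]

/-- The agent propositions in a propositionalized formula. -/
def agentVars (f : PBool (LTLf (X ⊕ Y))) : Finset (X ⊕ Y) := f.props.filter fun p => p.isRight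

/-- The environment propositions in a propositionalized formula. -/
def envVars (f : PBool (LTLf (X ⊕ Y))) : Finset (X ⊕ Y) := f.props.filter fun p => p.isLeft

/-- The generator `DpllGetOrArcs`. -/
def dpllGetOrArcs (D : DpllRealization (X ⊕ Y)) (f : PBool (LTLf (X ⊕ Y))) (ass : Move (X ⊕ Y)) :
    Option (List (Move (X ⊕ Y) × Node (X ⊕ Y))) :=
  if hV : (agentVars f).Nonempty then do
    let ℓ := D.branchingLiteral (agentVars f) f hV
    let l₁ ← dpllGetOrArcs D (D.replace f ℓ) (insert ℓ ass)
    let l₂ ← dpllGetOrArcs D (D.replace f (ℓ.1, !ℓ.2)) (insert (ℓ.1, !ℓ.2) ass)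
    return l₁ ++ l₂
  else
    return [(ass, .andNode f.toFormula)]
  partial_fixpoint

/-- The generator `DpllGetAndArcs`. -/
def dpllGetAndArcs (D : DpllRealization (X ⊕ Y)) (f : PBool (LTLf (X ⊕ Y))) (ass : Move (X ⊕ Y)) :
    Option (List (Move (X ⊕ Y) × Node (X ⊕ Y))) :=
  if hV : (envVars f).Nonempty then do
    let ℓ := D.branchingLiteral (envVars f) f hV
    let l₁ ← dpllGetAndArcs D (D.replace f ℓ) (insert ℓ ass)
    let l₂ ← dpllGetAndArcs D (D.replace f (ℓ.1, !ℓ.2)) (insert (ℓ.1, !ℓ.2) ass)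
    return l₁ ++ l₂
  else
    return [(ass, .orNode f.rmNext)]
  partial_fixpoint

/-- The generator `DpllGetArcs`. -/
def dpllGetArcs (D : DpllRealization (X ⊕ Y)) (n : Node (X ⊕ Y)) :
    Option (List (Move (X ⊕ Y) × Node (X ⊕ Y))) :=
  let f := n.formula.xnf.propositionalize
  match n with
  | .orNode _ => dpllGetOrArcs D f ∅
  | .andNode _ => dpllGetAndArcs D f ∅

end Dpll

/-! ## Forward AND-OR graph search -/

/-- A strategy: a list of pairs of a state formula and the agent move chosen there. The move `true`
is the empty set of literals. -/
abbrev Strategy (P : Type*) := List (LTLf P × Move P)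

/-- The mutable data of the search: the formulas of the OR-nodes that carry a success, failure or
loop tag, the steps `(n, succ)` between OR-nodes taken so far, and the strategy built so far. -/
structure SearchState (P : Type*) where
  success : List (LTLf P)
  failure : List (LTLf P)
  loop : List (LTLf P)
  steps : List (LTLf P × LTLf P)
  strategy : Strategy P

/-- The building blocks of the search: `equivalenceCheck` on the formulas of OR-nodes and the
generator `getArcs` of the outgoing arcs of a node. -/
structure SearchBlocks (P : Type*) where
  equivalenceCheck : LTLf P → LTLf P → Bool
  getArcs : Node P → Option (List (Move P × Node P))

namespace SearchBlocks

variable {P : Type*} (B : SearchBlocks P)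

/-- Some formula in the list is equivalent to `ψ`. -/
def mem (ψ : LTLf P) (L : List (LTLf P)) : Bool := L.any (B.equivalenceCheck ψ)

/-- The move that a strategy gives to a state formula, up to equivalence. -/
def lookup (S : Strategy P) (ψ : LTLf P) : Option (Move P) :=
  (S.find? fun e => B.equivalenceCheck ψ e.1).map Prod.snd

/-- `AddToStrategy`; a move that has already been fixed is kept. -/
def addToStrategy (ψ : LTLf P) (act : Move P) (S : Strategy P) : Strategy P :=
  if (B.lookup S ψ).isSome then S else S ++ [(ψ, act)]

/-- `TagSuccessNode` followed by `AddToStrategy`. -/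
def succeed (ψ : LTLf P) (act : Move P) (st : SearchState P) : SearchState P :=
  { st with
    success := ψ :: st.success
    strategy := B.addToStrategy ψ act st.strategy }

/-- `k` rounds of adding to `L` the predecessors, along `steps`, of its members. -/
def predecessors (steps : List (LTLf P × LTLf P)) : ℕ → List (LTLf P) → List (LTLf P)
  | 0, L => L
  | k + 1, L =>
    predecessors steps k
      (L ++ (steps.filter fun e => B.mem e.2 L && !B.mem e.1 L).map Prod.fst)

/-- The node `ψ` and its ancestors in the part of the graph that has been searched. -/
def ancestors (st : SearchState P) (ψ : LTLf P) : List (LTLf P) :=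
  B.predecessors st.steps st.steps.length [ψ]

/-- The first of the given OR-arcs all of whose responses lead to nodes with a success tag. -/
def findSuccessMove (st : SearchState P) :
    List (Move P × Node P) → Option (Option (Move P))
  | [] => some none
  | (act, m) :: arcs => do
    let responses ← B.getArcs m
    if responses.all fun r => B.mem r.2.formula st.success then
      return some act
    else
      findSuccessMove st arcs

/-- One pass over `L`: a node without success tag that has a move all of whose responses lead to
success nodes becomes a success node with that move. -/
def propagateOnce : List (LTLf P) → SearchState P → Option (SearchState P)
  | [], st => some st
  | ψ :: L, st => do
    if B.mem ψ st.success then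
      propagateOnce L st
    else
      let arcs ← B.getArcs (.orNode ψ)
      match ← B.findSuccessMove st arcs with
      | some act => propagateOnce L (B.succeed ψ act st)
      | none => propagateOnce L st

/-- `k` passes over `L`. -/
def propagate (L : List (LTLf P)) : ℕ → SearchState P → Option (SearchState P)
  | 0, st => some st
  | k + 1, st => do
    let st' ← B.propagateOnce L st
    propagate L k st'

/-- `BackProp ψ`, called when a node at which a loop was found turns out to be a success node. The
failure tags of the ancestors of the node, which were set while it was provisionally considered
a failure, are withdrawn, and its success is propagated backwards through its ancestors. -/
def backProp (ψ : LTLf P) (st : SearchState P) : Option (SearchState P) :=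
  let L := B.ancestors st ψ
  B.propagate L L.length { st with failure := st.failure.filter fun m => !B.mem m L }

mutual

/-- The procedure `Search` at the OR-node with formula `ψ`. -/
def search (ψ : LTLf P) (path : List (LTLf P)) (st : SearchState P) :
    Option (Bool × SearchState P) :=
  if B.mem ψ st.success then some (true, st)
  else if B.mem ψ st.failure then some (false, st)
  else if B.mem ψ path then some (false, { st with loop := ψ :: st.loop })
  else if ψ.isAccepting then some (true, B.succeed ψ ∅ st)
  else do
    let arcs ← B.getArcs (.orNode ψ)
    searchOr ψ path arcs st
  partial_fixpoint

/-- The outer loop of `Search`, over the OR-arcs of `ψ`, with the statements that follow it. -/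
def searchOr (ψ : LTLf P) (path : List (LTLf P)) (arcs : List (Move P × Node P))
    (st : SearchState P) : Option (Bool × SearchState P) :=
  match arcs with
  | [] => some (false, { st with failure := ψ :: st.failure })
  | (act, m) :: arcs => do
    let responses ← B.getArcs m
    let (found, st) ← searchAnd ψ path responses st
    if found then
      let st := B.succeed ψ act st
      if B.mem ψ st.loop then
        let st ← B.backProp ψ st
        return (true, st)
      else
        return (true, st)
    else
      searchOr ψ path arcs st
  partial_fixpoint

/-- The inner loop of `Search`, over the AND-arcs of one AND-node below `ψ`. -/
def searchAnd (ψ : LTLf P) (path : List (LTLf P)) (responses : List (Move P × Node P))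
    (st : SearchState P) : Option (Bool × SearchState P) :=
  match responses with
  | [] => some (true, st)
  | (_, succ) :: responses => do
    let st := { st with steps := (ψ, succ.formula) :: st.steps }
    let (found, st) ← search succ.formula (path ++ [ψ]) st
    if found then
      searchAnd ψ path responses st
    else
      return (false, st)
  partial_fixpoint

end

end SearchBlocks

/-- The output of the synthesis procedure. -/
inductive Answer (P : Type*) where
  | strategy : Strategy P → Answer P
  | unrealizable : Answer P

/-- The procedure `Synthesis`; the value is `none` if it does not terminate. -/
def synthesis {P : Type*} (B : SearchBlocks P) (φ : LTLf P) : Option (Answer P) :=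
  let st : SearchState P := ⟨[], [], [], [], []⟩
  if φ.isAccepting then
    some (.strategy (B.addToStrategy φ ∅ st.strategy))
  else do
    let (found, st) ← B.search φ [] st
    if found then return .strategy st.strategy else return .unrealizable

/-- The search with `BddBasedEqCheck` as equivalence check and `DpllGetArcs` as node expansion. -/
def bddDpllBlocks {X Y : Type*} [DecidableEq X] [DecidableEq Y] (ord : List (LTLf (X ⊕ Y)))
    (D : DpllRealization (X ⊕ Y)) : SearchBlocks (X ⊕ Y) where
  equivalenceCheck := bddBasedEqCheck ord
  getArcs := dpllGetArcs D

/-! ## LTLf synthesis -/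

section Synthesis

variable {X Y : Type*}

/-- The trace produced by the agent function `g` against a finite sequence of environment moves. -/
def playTrace (g : List (Set X) → Set Y) (h : List (Set X)) : List (Set (X ⊕ Y)) :=
  h.mapIdx fun i A => Sum.inl '' A ∪ Sum.inr '' g (h.take i)

/-- `g` wins: on every infinite sequence of environment moves some finite prefix of the play,
possibly the empty one, satisfies `φ`. -/
def Wins (φ : LTLf (X ⊕ Y)) (g : List (Set X) → Set Y) : Prop :=
  ∀ env : ℕ → Set X, ∃ k : ℕ, LTLf.Sat (playTrace g ((List.range k).map env)) φ

/-- `g` wins on nonempty traces: on every infinite sequence of environment moves some nonempty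
finite prefix of the play satisfies `φ`. -/
def WinsNonempty (φ : LTLf (X ⊕ Y)) (g : List (Set X) → Set Y) : Prop :=
  ∀ env : ℕ → Set X, ∃ k : ℕ, LTLf.Sat (playTrace g ((List.range (k + 1)).map env)) φ

/-- `g` implements the strategy `S` for `φ`: after every history, if `S` gives a move to the current
state formula, the progression of `φ` through the play so far, then `g` plays a completion of it. -/
def Implements (B : SearchBlocks (X ⊕ Y)) (φ : LTLf (X ⊕ Y)) (S : Strategy (X ⊕ Y))
    (g : List (Set X) → Set Y) : Prop :=
  ∀ (h : List (Set X)) (act : Move (X ⊕ Y)),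
    B.lookup S (LTLf.fpTrace φ (playTrace g h)) = some act →
      ∀ ℓ ∈ act, Literal.True (Sum.inr '' g h) ℓ

/-- An answer for `φ` is correct with respect to the winning condition `Win`: it is `unrealizable`
only if no agent function wins, and a strategy is returned only if it can be implemented and all
its implementations win. -/
def Answer.Correct (B : SearchBlocks (X ⊕ Y)) (φ : LTLf (X ⊕ Y))
    (Win : (List (Set X) → Set Y) → Prop) : Answer (X ⊕ Y) → Prop
  | .unrealizable => ¬ ∃ g, Win g
  | .strategy S => (∃ g, Implements B φ S g) ∧ ∀ g, Implements B φ S g → Win g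

end Synthesis

/-! Correctness of LTLf synthesis by forward AND-OR search with decision diagrams as equivalence
check.

A finite trace satisfies `φ` iff the progression of `φ` through the trace accepts the empty trace
(`sat_iff_isAccepting_fpTrace`), so synthesis is a reachability game on formulas. All formulas that
occur are positive Boolean combinations of `cl φ` (`IsState`), and progression acts on the Boolean
function of the next normal form by pulling back assignments of the atoms (`xnfHolds_fp`). For
formulas over the variables of the ordering, equality of diagrams is equality of these functions
(`holds_bddRepresentation`, `bddRepresentation_congr`); hence it is a congruence of the game, and it
has finitely many classes. An OR-arc followed by an AND-arc leads to the progression of the formula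
up to this equivalence (`dpllGetArcs_spec`), whatever branching and simplification are used.

The search is analysed over an abstract game with these properties (`Arena`). It terminates because
the classes on a path are distinct. A strategy is sound because each of its entries leads to
accepting formulas or to earlier entries (`Arena.Ranked`). For failure tags the point is that a tag
may depend on loops. The invariant says that from every formula tagged failure the environment can
avoid acceptance until the play enters a formula that is still on the path and at which a loop has
been found, and that it can do so along recorded steps (`Arena.spoiled`). When such a formula `ψ`
leaves the path as a failure, it is itself spoiled and can be dropped as a target
(`Arena.spoiled_of_refuted`). When it leaves as a success, `BackProp` withdraws the failure tags of
all formulas with recorded steps leading to `ψ`, and the remaining ones do not depend on `ψ`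
(`Arena.Invariant.backProp`). At the root the path is empty, so that failure means that the
environment avoids acceptance forever. Correctness does not depend on how much success `BackProp`
propagates. -/

namespace LTLf

variable {P : Type*}

/-! ### Progression and satisfaction -/

theorem holds_nil_iff (φ : LTLf P) : holds [] 0 φ ↔ φ.isAccepting = true := by
  induction φ <;> simp_all [holds, isAccepting]

theorem holds_cons_succ (σ : Set P) (ρ : List (Set P)) (φ : LTLf P) (i : ℕ) :
    holds (σ :: ρ) (i + 1) φ ↔ holds ρ i φ := by
  induction φ generalizing i with
  | tt | ff => simp [holds]
  | pos p | neg p => simp [holds]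
  | and φ ψ hφ hψ | or φ ψ hφ hψ => simp [holds, hφ, hψ]
  | next φ hφ | wnext φ hφ => simp [holds, hφ]
  | unt φ ψ hφ hψ =>
    simp only [holds]
    constructor
    · rintro ⟨j, hij, hj, h, hk⟩
      obtain ⟨j, rfl⟩ : ∃ j', j = j' + 1 := ⟨j - 1, by omega⟩
      refine ⟨j, by omega, by simpa using hj, (hψ j).1 h, fun k h1 h2 => (hφ k).1 ?_⟩
      exact hk (k + 1) (by omega) (by omega)
    · rintro ⟨j, hij, hj, h, hk⟩
      refine ⟨j + 1, by omega, by simpa using hj, (hψ j).2 h, fun k h1 h2 => ?_⟩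
      obtain ⟨k, rfl⟩ : ∃ k', k = k' + 1 := ⟨k - 1, by omega⟩
      exact (hφ k).2 (hk k (by omega) (by omega))
  | rel φ ψ hφ hψ =>
    simp only [holds]
    constructor
    · intro H j hij hj
      rcases H (j + 1) (by omega) (by simpa using hj) with h | ⟨k, h1, h2, h⟩
      · exact .inl ((hψ j).1 h)
      · obtain ⟨k, rfl⟩ : ∃ k', k = k' + 1 := ⟨k - 1, by omega⟩
        exact .inr ⟨k, by omega, by omega, (hφ k).1 h⟩
    · intro H j hij hj
      obtain ⟨j, rfl⟩ : ∃ j', j = j' + 1 := ⟨j - 1, by omega⟩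
      rcases H j (by omega) (by simpa using hj) with h | ⟨k, h1, h2, h⟩
      · exact .inl ((hψ j).2 h)
      · exact .inr ⟨k + 1, by omega, by omega, (hφ k).2 h⟩

theorem holds_unt_zero (σ : Set P) (ρ : List (Set P)) (φ ψ : LTLf P) :
    holds (σ :: ρ) 0 (unt φ ψ) ↔
      holds (σ :: ρ) 0 ψ ∨ (holds (σ :: ρ) 0 φ ∧ holds ρ 0 (unt φ ψ)) := by
  rw [← holds_cons_succ σ ρ (unt φ ψ) 0]
  simp only [holds]
  constructor
  · rintro ⟨j, -, hj, h, hk⟩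
    rcases Nat.eq_zero_or_pos j with rfl | hpos
    · exact .inl h
    · exact .inr ⟨hk 0 le_rfl hpos, j, hpos, hj, h, fun k _ h2 => hk k (by omega) h2⟩
  · rintro (h | ⟨h0, j, h1, hj, h, hk⟩)
    · exact ⟨0, le_rfl, by simp, h, fun k _ h2 => absurd h2 (by omega)⟩
    · refine ⟨j, by omega, hj, h, fun k _ h2 => ?_⟩
      rcases Nat.eq_zero_or_pos k with rfl | hpos
      · exact h0
      · exact hk k hpos h2

theorem holds_rel_zero (σ : Set P) (ρ : List (Set P)) (φ ψ : LTLf P) :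
    holds (σ :: ρ) 0 (rel φ ψ) ↔
      holds (σ :: ρ) 0 ψ ∧ (holds (σ :: ρ) 0 φ ∨ holds ρ 0 (rel φ ψ)) := by
  rw [← holds_cons_succ σ ρ (rel φ ψ) 0]
  simp only [holds]
  constructor
  · intro H
    refine ⟨?_, ?_⟩
    · rcases H 0 le_rfl (by simp) with h | ⟨k, _, h2, _⟩
      · exact h
      · omega
    · by_cases h0 : holds (σ :: ρ) 0 φ
      · exact .inl h0
      · refine .inr fun j h1 hj => ?_
        rcases H j (by omega) hj with h | ⟨k, _, h2, h⟩
        · exact .inl h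
        · rcases Nat.eq_zero_or_pos k with rfl | hpos
          · exact absurd h h0
          · exact .inr ⟨k, hpos, h2, h⟩
  · rintro ⟨h0, H⟩ j - hj
    rcases Nat.eq_zero_or_pos j with rfl | hpos
    · exact .inl h0
    · rcases H with h | H
      · exact .inr ⟨0, le_rfl, hpos, h⟩
      · rcases H j hpos hj with h | ⟨k, _, h2, h⟩
        · exact .inl h
        · exact .inr ⟨k, by omega, h2, h⟩

theorem fp_unt {φ ψ : LTLf P} (σ : Set P) (h : φ = tt → ψ = tt → False) :
    fp σ (unt φ ψ) = or (fp σ ψ) (and (fp σ φ) (and (unt φ ψ) notEnd)) := by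
  rw [fp]; exact h

theorem fp_rel {φ ψ : LTLf P} (σ : Set P) (h : φ = ff → ψ = ff → False) :
    fp σ (rel φ ψ) = and (fp σ ψ) (or (fp σ φ) (or (rel φ ψ) atEnd)) := by
  rw [fp]; exact h

theorem xnf_unt {φ ψ : LTLf P} (h : φ = tt → ψ = tt → False) :
    xnf (unt φ ψ) = or (and (xnf ψ) notEnd) (and (xnf φ) (next (unt φ ψ))) := by
  rw [xnf]; exact h

theorem xnf_rel {φ ψ : LTLf P} (h : φ = ff → ψ = ff → False) :
    xnf (rel φ ψ) = and (or (xnf ψ) atEnd) (or (xnf φ) (wnext (rel φ ψ))) := by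
  rw [xnf]; exact h

theorem holds_notEnd (ρ : List (Set P)) : holds ρ 0 notEnd ↔ 0 < ρ.length := by
  simp only [notEnd, holds]
  exact ⟨fun ⟨j, _, h, _⟩ => by omega, fun h => ⟨0, le_rfl, h, trivial, fun _ _ _ => trivial⟩⟩

theorem holds_atEnd (ρ : List (Set P)) : holds ρ 0 atEnd ↔ ρ.length = 0 := by
  simp only [atEnd, holds]
  constructor
  · intro H
    by_contra h
    rcases H 0 le_rfl (by omega) with h | ⟨_, _, _, h⟩ <;> exact h
  · intro h j _ hj
    omega

theorem holds_cons_zero (σ : Set P) (ρ : List (Set P)) (φ : LTLf P) :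
    holds (σ :: ρ) 0 φ ↔ holds ρ 0 (fp σ φ) := by
  induction φ with
  | tt | ff => simp [holds, fp]
  | pos p | neg p => by_cases h : p ∈ σ <;> simp [holds, fp, h]
  | and φ ψ hφ hψ | or φ ψ hφ hψ => simp [holds, fp, hφ, hψ]
  | next φ hφ => simp [holds, fp, holds_cons_succ, holds_notEnd, and_comm]
  | wnext φ hφ =>
    simp [holds, fp, holds_cons_succ, holds_atEnd, imp_iff_or_not]
  | unt φ ψ hφ hψ =>
    by_cases h : φ = tt ∧ ψ = tt
    · obtain ⟨rfl, rfl⟩ := h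
      simp only [fp]
      exact iff_of_true ((holds_notEnd (σ :: ρ)).2 (by simp)) trivial
    · rw [fp_unt σ (fun h1 h2 => h ⟨h1, h2⟩), holds_unt_zero, hφ, hψ]
      have : holds ρ 0 (unt φ ψ) → holds ρ 0 notEnd := by
        rw [holds_notEnd]
        rintro ⟨j, _, hj, _⟩
        omega
      rw [holds, holds, holds, and_iff_left_of_imp this]
  | rel φ ψ hφ hψ =>
    by_cases h : φ = ff ∧ ψ = ff
    · obtain ⟨rfl, rfl⟩ := h
      simp only [fp]
      exact iff_of_false ((holds_atEnd (σ :: ρ)).not.2 (by simp)) id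
    · rw [fp_rel σ (fun h1 h2 => h ⟨h1, h2⟩), holds_rel_zero, hφ, hψ]
      have : holds ρ 0 atEnd → holds ρ 0 (rel φ ψ) := by
        rw [holds_atEnd]
        intro h j _ hj
        omega
      rw [holds, holds, holds, or_iff_left_of_imp this]

/-- A trace satisfies a formula iff the progression of the formula through the trace accepts the
empty trace. This reduces synthesis to a reachability game on formulas. -/
theorem sat_iff_isAccepting_fpTrace (φ : LTLf P) (ρ : List (Set P)) :
    Sat ρ φ ↔ (fpTrace φ ρ).isAccepting = true := by
  induction ρ generalizing φ with
  | nil => exact holds_nil_iff φ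
  | cons σ ρ ih => exact (holds_cons_zero σ ρ φ).trans (ih (fp σ φ))

theorem fpTrace_append_singleton (φ : LTLf P) (ρ : List (Set P)) (σ : Set P) :
    fpTrace φ (ρ ++ [σ]) = fp σ (fpTrace φ ρ) := by
  simp [fpTrace]

/-! ### The Boolean function of the next normal form -/

/-- Truth of a state formula under an assignment `C` of the atoms of its next normal form. -/
def XnfHolds (C : Set (LTLf P)) (ψ : LTLf P) : Prop := PBool.Holds C ψ.xnf.propositionalize

/-- The assignment of the atoms that gives each atom the truth value of its progression through `σ`
under `C`. -/
def pullback (C : Set (LTLf P)) (σ : Set P) : Set (LTLf P) := {α | XnfHolds C (fp σ α)}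

@[simp] theorem xnf_notEnd : xnf (notEnd : LTLf P) = notEnd := by simp [notEnd, xnf]

@[simp] theorem xnf_atEnd : xnf (atEnd : LTLf P) = atEnd := by simp [atEnd, xnf]

theorem xnfHolds_and {C : Set (LTLf P)} {φ ψ : LTLf P} :
    XnfHolds C (and φ ψ) ↔ XnfHolds C φ ∧ XnfHolds C ψ := Iff.rfl

theorem xnfHolds_or {C : Set (LTLf P)} {φ ψ : LTLf P} :
    XnfHolds C (or φ ψ) ↔ XnfHolds C φ ∨ XnfHolds C ψ := Iff.rfl

theorem xnfHolds_notEnd {C : Set (LTLf P)} : XnfHolds C notEnd ↔ notEnd ∈ C := by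
  rw [XnfHolds, xnf_notEnd]
  rfl

theorem xnfHolds_atEnd {C : Set (LTLf P)} : XnfHolds C atEnd ↔ atEnd ∈ C := by
  rw [XnfHolds, xnf_atEnd]
  rfl

theorem xnfHolds_unt {C : Set (LTLf P)} {φ ψ : LTLf P} (h : φ = tt → ψ = tt → False) :
    XnfHolds C (unt φ ψ) ↔
      XnfHolds C ψ ∧ notEnd ∈ C ∨ XnfHolds C φ ∧ next (unt φ ψ) ∈ C := by
  rw [XnfHolds, xnf_unt h]
  rfl

theorem xnfHolds_rel {C : Set (LTLf P)} {φ ψ : LTLf P} (h : φ = ff → ψ = ff → False) :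
    XnfHolds C (rel φ ψ) ↔
      (XnfHolds C ψ ∨ atEnd ∈ C) ∧ (XnfHolds C φ ∨ wnext (rel φ ψ) ∈ C) := by
  rw [XnfHolds, xnf_rel h]
  rfl

theorem notEnd_mem_pullback (C : Set (LTLf P)) (σ : Set P) : notEnd ∈ pullback C σ := by
  simp [pullback, XnfHolds, notEnd, fp, xnf, propositionalize, PBool.Holds]

theorem atEnd_notMem_pullback (C : Set (LTLf P)) (σ : Set P) : atEnd ∉ pullback C σ := by
  simp [pullback, XnfHolds, atEnd, fp, xnf, propositionalize, PBool.Holds]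

/-- Progression acts on the Boolean function of the next normal form by pulling back assignments.
Hence formulas with the same Boolean function have progressions with the same Boolean function. -/
theorem xnfHolds_fp (C : Set (LTLf P)) (σ : Set P) (ψ : LTLf P) :
    XnfHolds C (fp σ ψ) ↔ XnfHolds (pullback C σ) ψ := by
  induction ψ with
  | tt | ff => rfl
  | pos p | neg p => rfl
  | and φ ψ hφ hψ => exact and_congr hφ hψ
  | or φ ψ hφ hψ => exact or_congr hφ hψ
  | next φ | wnext φ => rfl
  | unt φ ψ hφ hψ =>
    by_cases h : φ = tt ∧ ψ = tt
    · obtain ⟨rfl, rfl⟩ := h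
      simp only [XnfHolds, xnf]
      rfl
    · have h' : φ = tt → ψ = tt → False := fun h1 h2 => h ⟨h1, h2⟩
      have hnext : next (unt φ ψ) ∈ pullback C σ ↔
          XnfHolds C (unt φ ψ) ∧ XnfHolds C notEnd := Iff.rfl
      rw [fp_unt σ h', xnfHolds_or, xnfHolds_and, xnfHolds_and, ← hnext, hφ, hψ,
        xnfHolds_unt (C := pullback C σ) h', and_iff_left (notEnd_mem_pullback C σ)]
  | rel φ ψ hφ hψ =>
    by_cases h : φ = ff ∧ ψ = ff
    · obtain ⟨rfl, rfl⟩ := h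
      simp only [XnfHolds, xnf]
      rfl
    · have h' : φ = ff → ψ = ff → False := fun h1 h2 => h ⟨h1, h2⟩
      have hnext : wnext (rel φ ψ) ∈ pullback C σ ↔
          XnfHolds C (rel φ ψ) ∨ XnfHolds C atEnd := Iff.rfl
      rw [fp_rel σ h', xnfHolds_and, xnfHolds_or, xnfHolds_or, ← hnext, hφ, hψ,
        xnfHolds_rel (C := pullback C σ) h', or_iff_left (atEnd_notMem_pullback C σ)]

/-- Acceptance is the value of the Boolean function at the set of accepting atoms. -/
theorem isAccepting_iff_xnfHolds (ψ : LTLf P) :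
    ψ.isAccepting = true ↔ XnfHolds {α | α.isAccepting = true} ψ := by
  induction ψ with
  | tt | ff | pos p | neg p | next φ | wnext φ =>
    simp [isAccepting, XnfHolds, xnf, propositionalize, PBool.Holds]
  | and φ ψ hφ hψ => simpa [isAccepting, xnfHolds_and] using and_congr hφ hψ
  | or φ ψ hφ hψ => simpa [isAccepting, xnfHolds_or] using or_congr hφ hψ
  | unt φ ψ hφ hψ =>
    by_cases h : φ = tt ∧ ψ = tt
    · obtain ⟨rfl, rfl⟩ := h
      exact (xnfHolds_notEnd (C := {α | α.isAccepting = true})).symm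
    · rw [xnfHolds_unt fun h1 h2 => h ⟨h1, h2⟩]
      simp [notEnd, isAccepting]
  | rel φ ψ hφ hψ =>
    by_cases h : φ = ff ∧ ψ = ff
    · obtain ⟨rfl, rfl⟩ := h
      exact (xnfHolds_atEnd (C := {α | α.isAccepting = true})).symm
    · rw [xnfHolds_rel fun h1 h2 => h ⟨h1, h2⟩]
      simp [atEnd, isAccepting]

theorem complementary_pullback (C : Set (LTLf P)) (σ : Set P) : Complementary (pullback C σ) := by
  intro p
  by_cases h : p ∈ σ <;>
    simp [pullback, XnfHolds, fp, h, xnf, propositionalize, PBool.Holds]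

theorem pos_mem_pullback {C : Set (LTLf P)} {σ : Set P} {p : P} :
    pos p ∈ pullback C σ ↔ p ∈ σ := by
  by_cases h : p ∈ σ <;>
    simp [pullback, XnfHolds, fp, h, xnf, propositionalize, PBool.Holds]

/-! ### State formulas -/

theorem constants_mem_subformulas (ψ : LTLf P) : tt ∈ subformulas ψ ∧ ff ∈ subformulas ψ := by
  induction ψ <;> simp_all [subformulas]

theorem self_mem_subformulas (ψ : LTLf P) : ψ ∈ subformulas ψ := by
  cases ψ <;> simp [subformulas]

theorem subformulas_subset {θ ψ : LTLf P} (h : θ ∈ subformulas ψ) :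
    subformulas θ ⊆ subformulas ψ := by
  have hc : ∀ ψ : LTLf P, ({tt, ff} : Set (LTLf P)) ⊆ subformulas ψ := fun ψ =>
    Set.insert_subset (constants_mem_subformulas ψ).1
      (Set.singleton_subset_iff.2 (constants_mem_subformulas ψ).2)
  induction ψ with
  | tt | ff =>
    rcases h with rfl | rfl <;> exact subset_rfl
  | pos p | neg p =>
    rcases h with rfl | rfl | rfl
    · exact subset_rfl
    · exact hc _
    · exact hc _
  | and φ ψ hφ hψ | or φ ψ hφ hψ | unt φ ψ hφ hψ | rel φ ψ hφ hψ =>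
    rcases h with rfl | h | h
    · exact subset_rfl
    · exact (hφ h).trans (Set.subset_union_left.trans (Set.subset_insert _ _))
    · exact (hψ h).trans (Set.subset_union_right.trans (Set.subset_insert _ _))
  | next φ hφ | wnext φ hφ =>
    rcases h with rfl | h
    · exact subset_rfl
    · exact (hφ h).trans (Set.subset_insert _ _)

theorem pa_subset_subformulas (ψ : LTLf P) : pa ψ ⊆ subformulas ψ := by
  induction ψ with
  | and φ ψ hφ hψ | or φ ψ hφ hψ =>
    exact (Set.union_subset_union hφ hψ).trans (Set.subset_insert _ _)
  | tt | ff => exact Set.empty_subset _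
  | _ => exact Set.singleton_subset_iff.2 (self_mem_subformulas _)

theorem subformulas_subset_cl {θ φ : LTLf P} (h : θ ∈ cl φ) : subformulas θ ⊆ cl φ := by
  rcases h with (h | h) | h
  · exact (subformulas_subset h).trans (Set.subset_union_left.trans Set.subset_union_left)
  · exact (subformulas_subset h).trans (Set.subset_union_right.trans Set.subset_union_left)
  · exact (subformulas_subset h).trans Set.subset_union_right

theorem notEnd_mem_cl (φ : LTLf P) : notEnd ∈ cl φ := .inl (.inr (self_mem_subformulas _))

theorem atEnd_mem_cl (φ : LTLf P) : atEnd ∈ cl φ := .inr (self_mem_subformulas _)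

/-- The positive Boolean combinations of formulas of `cl φ`: all formulas that occur at OR-nodes of
the search for `φ`. -/
def IsState (φ ψ : LTLf P) : Prop := pa ψ ⊆ cl φ

theorem isState_of_mem_subformulas {φ θ ψ : LTLf P} (hθ : θ ∈ cl φ) (h : ψ ∈ subformulas θ) :
    IsState φ ψ :=
  ((pa_subset_subformulas ψ).trans (subformulas_subset h)).trans (subformulas_subset_cl hθ)

theorem isState_self (φ : LTLf P) : IsState φ φ :=
  isState_of_mem_subformulas (.inl (.inl (self_mem_subformulas φ))) (self_mem_subformulas φ)

theorem isState_and {φ α β : LTLf P} : IsState φ (and α β) ↔ IsState φ α ∧ IsState φ β :=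
  Set.union_subset_iff

theorem isState_or {φ α β : LTLf P} : IsState φ (or α β) ↔ IsState φ α ∧ IsState φ β :=
  Set.union_subset_iff

theorem isState_tt (φ : LTLf P) : IsState φ tt := Set.empty_subset _

theorem isState_ff (φ : LTLf P) : IsState φ ff := Set.empty_subset _

theorem isState_notEnd (φ : LTLf P) : IsState φ notEnd :=
  Set.singleton_subset_iff.2 (notEnd_mem_cl φ)

theorem isState_atEnd (φ : LTLf P) : IsState φ atEnd :=
  Set.singleton_subset_iff.2 (atEnd_mem_cl φ)

theorem IsState.next_arg {φ α : LTLf P} (h : IsState φ (next α)) : IsState φ α :=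
  isState_of_mem_subformulas (h rfl) (.inr (self_mem_subformulas _))

theorem IsState.wnext_arg {φ α : LTLf P} (h : IsState φ (wnext α)) : IsState φ α :=
  isState_of_mem_subformulas (h rfl) (.inr (self_mem_subformulas _))

theorem IsState.unt_args {φ α β : LTLf P} (h : IsState φ (unt α β)) :
    IsState φ α ∧ IsState φ β :=
  ⟨isState_of_mem_subformulas (h rfl) (.inr (.inl (self_mem_subformulas _))),
    isState_of_mem_subformulas (h rfl) (.inr (.inr (self_mem_subformulas _)))⟩

theorem IsState.rel_args {φ α β : LTLf P} (h : IsState φ (rel α β)) :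
    IsState φ α ∧ IsState φ β :=
  ⟨isState_of_mem_subformulas (h rfl) (.inr (.inl (self_mem_subformulas _))),
    isState_of_mem_subformulas (h rfl) (.inr (.inr (self_mem_subformulas _)))⟩

theorem IsState.fp {φ ψ : LTLf P} (σ : Set P) (h : IsState φ ψ) : IsState φ (ψ.fp σ) := by
  induction ψ with
  | tt | ff => exact h
  | pos p | neg p =>
    simp only [LTLf.fp]
    split
    · exact isState_tt φ
    · exact isState_ff φ
  | and α β hα hβ =>
    exact isState_and.2 ⟨hα (isState_and.1 h).1, hβ (isState_and.1 h).2⟩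
  | or α β hα hβ =>
    exact isState_or.2 ⟨hα (isState_or.1 h).1, hβ (isState_or.1 h).2⟩
  | next α => exact isState_and.2 ⟨h.next_arg, isState_notEnd φ⟩
  | wnext α => exact isState_or.2 ⟨h.wnext_arg, isState_atEnd φ⟩
  | unt α β hα hβ =>
    by_cases h' : α = tt ∧ β = tt
    · obtain ⟨rfl, rfl⟩ := h'
      simpa only [LTLf.fp] using isState_tt φ
    · rw [fp_unt σ fun h1 h2 => h' ⟨h1, h2⟩]
      exact isState_or.2 ⟨hβ h.unt_args.2, isState_and.2 ⟨hα h.unt_args.1,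
        isState_and.2 ⟨h, isState_notEnd φ⟩⟩⟩
  | rel α β hα hβ =>
    by_cases h' : α = ff ∧ β = ff
    · obtain ⟨rfl, rfl⟩ := h'
      simpa only [LTLf.fp] using isState_ff φ
    · rw [fp_rel σ fun h1 h2 => h' ⟨h1, h2⟩]
      exact isState_and.2 ⟨hβ h.rel_args.2, isState_or.2 ⟨hα h.rel_args.1,
        isState_or.2 ⟨h, isState_atEnd φ⟩⟩⟩

theorem IsState.fpTrace {φ ψ : LTLf P} (ρ : List (Set P)) (h : IsState φ ψ) :
    IsState φ (ψ.fpTrace ρ) := by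
  induction ρ generalizing ψ with
  | nil => exact h
  | cons σ ρ ih => exact ih (h.fp σ)

/-- The shape of the atoms of the next normal forms of the state formulas for `φ`. -/
inductive IsXnfAtom (φ : LTLf P) : LTLf P → Prop
  | pos (p : P) : IsXnfAtom φ (pos p)
  | neg (p : P) : IsXnfAtom φ (neg p)
  | next {α : LTLf P} (h : IsState φ α) : IsXnfAtom φ (next α)
  | wnext {α : LTLf P} (h : IsState φ α) : IsXnfAtom φ (wnext α)
  | notEnd : IsXnfAtom φ notEnd
  | atEnd : IsXnfAtom φ atEnd

theorem IsState.isXnfAtom {φ ψ : LTLf P} (h : IsState φ ψ) : ∀ α ∈ pa ψ.xnf, IsXnfAtom φ α := by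
  induction ψ with
  | tt | ff => intro α hα; exact hα.elim
  | pos p => rintro _ rfl; exact .pos p
  | neg p => rintro _ rfl; exact .neg p
  | and α β hα hβ =>
    rintro γ (hγ | hγ)
    · exact hα (isState_and.1 h).1 γ hγ
    · exact hβ (isState_and.1 h).2 γ hγ
  | or α β hα hβ =>
    rintro γ (hγ | hγ)
    · exact hα (isState_or.1 h).1 γ hγ
    · exact hβ (isState_or.1 h).2 γ hγ
  | next α => rintro _ rfl; exact .next h.next_arg
  | wnext α => rintro _ rfl; exact .wnext h.wnext_arg
  | unt α β hα hβ =>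
    by_cases h' : α = tt ∧ β = tt
    · obtain ⟨rfl, rfl⟩ := h'
      simp only [xnf]
      rintro _ rfl
      exact .notEnd
    · rw [xnf_unt fun h1 h2 => h' ⟨h1, h2⟩]
      rintro γ ((hγ | rfl) | (hγ | rfl))
      · exact hβ h.unt_args.2 γ hγ
      · exact .notEnd
      · exact hα h.unt_args.1 γ hγ
      · exact .next h
  | rel α β hα hβ =>
    by_cases h' : α = ff ∧ β = ff
    · obtain ⟨rfl, rfl⟩ := h'
      simp only [xnf]
      rintro _ rfl
      exact .atEnd
    · rw [xnf_rel fun h1 h2 => h' ⟨h1, h2⟩]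
      rintro γ ((hγ | rfl) | (hγ | rfl))
      · exact hβ h.rel_args.2 γ hγ
      · exact .atEnd
      · exact hα h.rel_args.1 γ hγ
      · exact .wnext h

theorem pa_xnf_subset_bddVars {φ ψ : LTLf P} (h : IsState φ ψ) : pa ψ.xnf ⊆ bddVars φ := by
  have atom : ∀ θ : LTLf P, θ ∈ cl φ → pa θ.xnf ⊆ bddVars φ := fun θ hθ =>
    Set.subset_biUnion_of_mem (u := fun θ => pa (xnf θ)) hθ
  induction ψ with
  | tt | ff => exact Set.empty_subset _
  | and α β hα hβ | or α β hα hβ =>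
    exact Set.union_subset (hα (Set.union_subset_iff.1 h).1) (hβ (Set.union_subset_iff.1 h).2)
  | _ => exact atom _ (h rfl)

theorem vars_propositionalize (ψ : LTLf P) : ψ.propositionalize.vars = pa ψ := by
  induction ψ with
  | and α β hα hβ | or α β hα hβ =>
    simp only [propositionalize, PBool.vars, pa, hα, hβ]
  | _ => rfl

end LTLf

namespace PBool

open LTLf

variable {P : Type*}

theorem toFormula_normal {φ : LTLf P} {f : PBool (LTLf P)} (h : ∀ α ∈ f.vars, IsXnfAtom φ α) :
    f.toFormula.xnf.propositionalize = f := by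
  induction f with
  | tt | ff => rfl
  | var α =>
    cases h α rfl with
    | notEnd => simp only [toFormula, xnf_notEnd]; rfl
    | atEnd => simp only [toFormula, xnf_atEnd]; rfl
    | _ => rfl
  | and f g hf hg | or f g hf hg =>
    simp only [toFormula, xnf, propositionalize]
    rw [hf fun α hα => h α (.inl hα), hg fun α hα => h α (.inr hα)]

theorem isState_rmNext {φ : LTLf P} {f : PBool (LTLf P)} (h : ∀ α ∈ f.vars, IsXnfAtom φ α)
    (hlit : ∀ p, LTLf.pos p ∉ f.vars ∧ LTLf.neg p ∉ f.vars) : IsState φ f.rmNext := by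
  induction f with
  | tt => exact isState_tt φ
  | ff => exact isState_ff φ
  | var α =>
    cases h α rfl with
    | pos p => exact ((hlit p).1 rfl).elim
    | neg p => exact ((hlit p).2 rfl).elim
    | next hα => exact isState_and.2 ⟨hα, isState_notEnd φ⟩
    | wnext hα => exact isState_or.2 ⟨hα, isState_atEnd φ⟩
    | notEnd => exact isState_tt φ
    | atEnd => exact isState_ff φ
  | and f g hf hg =>
    exact isState_and.2 ⟨hf (fun α hα => h α (.inl hα)) fun p =>
        ⟨fun hp => (hlit p).1 (.inl hp), fun hp => (hlit p).2 (.inl hp)⟩,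
      hg (fun α hα => h α (.inr hα)) fun p =>
        ⟨fun hp => (hlit p).1 (.inr hp), fun hp => (hlit p).2 (.inr hp)⟩⟩
  | or f g hf hg =>
    exact isState_or.2 ⟨hf (fun α hα => h α (.inl hα)) fun p =>
        ⟨fun hp => (hlit p).1 (.inl hp), fun hp => (hlit p).2 (.inl hp)⟩,
      hg (fun α hα => h α (.inr hα)) fun p =>
        ⟨fun hp => (hlit p).1 (.inr hp), fun hp => (hlit p).2 (.inr hp)⟩⟩

/-- Once no literal is left, `RmNext` agrees with progression through any instant `σ`. -/
theorem xnfHolds_rmNext {φ : LTLf P} {f : PBool (LTLf P)} (h : ∀ α ∈ f.vars, IsXnfAtom φ α)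
    (hlit : ∀ p, LTLf.pos p ∉ f.vars ∧ LTLf.neg p ∉ f.vars) (C : Set (LTLf P)) (σ : Set P) :
    XnfHolds C f.rmNext ↔ f.Holds (pullback C σ) := by
  induction f with
  | tt | ff => rfl
  | var α =>
    cases h α rfl with
    | pos p => exact ((hlit p).1 rfl).elim
    | neg p => exact ((hlit p).2 rfl).elim
    | next hα => rfl
    | wnext hα => rfl
    | notEnd => simp only [LTLf.notEnd, rmNext, Holds, pullback, LTLf.fp, Set.mem_ofPred_eq]
    | atEnd => simp only [LTLf.atEnd, rmNext, Holds, pullback, LTLf.fp, Set.mem_ofPred_eq]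
  | and f g hf hg =>
    exact and_congr (hf (fun α hα => h α (.inl hα)) fun p =>
        ⟨fun hp => (hlit p).1 (.inl hp), fun hp => (hlit p).2 (.inl hp)⟩)
      (hg (fun α hα => h α (.inr hα)) fun p =>
        ⟨fun hp => (hlit p).1 (.inr hp), fun hp => (hlit p).2 (.inr hp)⟩)
  | or f g hf hg =>
    exact or_congr (hf (fun α hα => h α (.inl hα)) fun p =>
        ⟨fun hp => (hlit p).1 (.inl hp), fun hp => (hlit p).2 (.inl hp)⟩)
      (hg (fun α hα => h α (.inr hα)) fun p =>
        ⟨fun hp => (hlit p).1 (.inr hp), fun hp => (hlit p).2 (.inr hp)⟩)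

end PBool

/-! ### Canonicity of reduced ordered decision diagrams -/

namespace PBool

variable {A : Type*}

theorem evalFalse_iff_holds_empty (f : PBool A) : f.evalFalse = true ↔ f.Holds ∅ := by
  induction f <;> simp_all [evalFalse, Holds]

theorem holds_congr {f : PBool A} {C C' : Set A} (h : ∀ a ∈ f.vars, a ∈ C ↔ a ∈ C') :
    f.Holds C ↔ f.Holds C' := by
  induction f with
  | tt | ff => rfl
  | var a => exact h a rfl
  | and f g hf hg => exact and_congr (hf fun a ha => h a (.inl ha)) (hg fun a ha => h a (.inr ha))
  | or f g hf hg => exact or_congr (hf fun a ha => h a (.inl ha)) (hg fun a ha => h a (.inr ha))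

variable [DecidableEq A]

theorem holds_assign (a : A) (b : Bool) (C : Set A) (f : PBool A) :
    (f.assign a b).Holds C ↔ f.Holds {c | if c = a then b = true else c ∈ C} := by
  induction f with
  | tt | ff => rfl
  | var c => by_cases h : c = a <;> cases b <;> simp [assign, Holds, h]
  | and f g hf hg => exact and_congr hf hg
  | or f g hf hg => exact or_congr hf hg

theorem vars_assign_subset (a : A) (b : Bool) (f : PBool A) :
    (f.assign a b).vars ⊆ f.vars \ {a} := by
  induction f with
  | tt | ff => exact Set.empty_subset _
  | var c =>
    by_cases h : c = a
    · cases b <;> simp [assign, vars, h]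
    · simp [assign, vars, h, Ne.symm h]
  | and f g hf hg | or f g hf hg =>
    simp only [assign, vars, Set.union_sdiff_distrib]
    exact Set.union_subset_union hf hg

end PBool

/-- Truth of the Boolean function that a decision diagram represents. -/
def BDD.Holds {A : Type*} (C : Set A) : BDD A → Prop
  | .leaf b => b = true
  | .node a lo hi => (a ∈ C ∧ hi.Holds C) ∨ (a ∉ C ∧ lo.Holds C)

section Bdd

variable {A : Type*} [DecidableEq A]

theorem holds_bddRepresentation (C : Set A) (ord : List A) (f : PBool A)
    (h : ∀ a ∈ f.vars, a ∈ ord) : (bddRepresentation ord f).Holds C ↔ f.Holds C := by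
  induction ord generalizing f with
  | nil =>
    rw [bddRepresentation, BDD.Holds, PBool.evalFalse_iff_holds_empty]
    exact PBool.holds_congr fun a ha => absurd (h a ha) List.not_mem_nil
  | cons a ord ih =>
    have hassign : ∀ b, (a ∈ C ↔ b = true) →
        ((bddRepresentation ord (f.assign a b)).Holds C ↔ f.Holds C) := by
      intro b hb
      rw [ih _ fun c hc => ?_, PBool.holds_assign]
      · refine PBool.holds_congr fun c _ => ?_
        by_cases hc : c = a <;> simp [hc, hb]
      · obtain ⟨hc, hne⟩ := PBool.vars_assign_subset a b f hc
        exact (List.mem_cons.1 (h c hc)).resolve_left hne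
    rw [bddRepresentation]
    by_cases ha : a ∈ C
    · have := hassign true (by simp [ha])
      split_ifs with hlh
      · rwa [hlh]
      · simpa [BDD.Holds, ha] using this
    · have := hassign false (by simp [ha])
      split_ifs with hlh
      · exact this
      · simpa [BDD.Holds, ha] using this

theorem bddRepresentation_congr (ord : List A) {f g : PBool A}
    (h : ∀ C, f.Holds C ↔ g.Holds C) : bddRepresentation ord f = bddRepresentation ord g := by
  induction ord generalizing f g with
  | nil =>
    simp only [bddRepresentation, BDD.leaf.injEq]
    rw [Bool.eq_iff_iff, PBool.evalFalse_iff_holds_empty, PBool.evalFalse_iff_holds_empty, h]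
  | cons a ord ih =>
    have hassign : ∀ b, bddRepresentation ord (f.assign a b) =
        bddRepresentation ord (g.assign a b) := fun b =>
      ih fun C => by rw [PBool.holds_assign, PBool.holds_assign, h]
    simp only [bddRepresentation, hassign]

theorem finite_range_bddRepresentation (ord : List A) :
    (Set.range (bddRepresentation ord)).Finite := by
  induction ord with
  | nil =>
    refine (Set.toFinite {BDD.leaf true, BDD.leaf false}).subset ?_
    rintro _ ⟨f, rfl⟩
    rw [bddRepresentation]
    cases f.evalFalse <;> simp
  | cons a ord ih =>
    refine (ih.image2 (fun lo hi => if lo = hi then lo else .node a lo hi) ih).subset ?_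
    rintro _ ⟨f, rfl⟩
    exact ⟨_, ⟨_, rfl⟩, _, ⟨_, rfl⟩, rfl⟩

end Bdd

/-! ### Expansion of search nodes -/

/-- Truth of a literal under an assignment of the atoms. -/
def Literal.TrueAtoms {P : Type*} (C : Set (LTLf P)) (ℓ : Literal P) : Prop :=
  ℓ.2 = true ↔ LTLf.pos ℓ.1 ∈ C

theorem Literal.true_or_true_not {P : Type*} (σ : Set P) (ℓ : Literal P) :
    Literal.True σ ℓ ∨ Literal.True σ (ℓ.1, !ℓ.2) := by
  by_cases h : ℓ.1 ∈ σ <;> cases h' : ℓ.2 <;> simp [Literal.True, h, h']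

theorem mem_props_iff {P : Type*} [DecidableEq P] (f : PBool (LTLf P)) (p : P) :
    p ∈ f.props ↔ LTLf.pos p ∈ f.vars ∨ LTLf.neg p ∈ f.vars := by
  induction f with
  | tt | ff => simp [PBool.props, PBool.vars]
  | and f g hf hg | or f g hf hg =>
    simp only [PBool.props, PBool.vars, Finset.mem_union, hf, hg, Set.mem_union]
    tauto
  | var α => cases α <;> simp [PBool.props, PBool.vars]

/-- A consistent move that mentions only propositions selected by `sel`. -/
def MoveOver {P : Type*} (sel : P → Bool) (ass : Move P) : Prop :=
  (∀ ℓ ∈ ass, sel ℓ.1 = true) ∧ ∀ ℓ ∈ ass, (ℓ.1, !ℓ.2) ∉ ass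

/-- The specification of the node expansion, for both kinds of nodes at once: `F` is either
generator, `sel` selects the propositions it branches on, and `leaf` is the node that it yields.
The moves cover all interpretations, and the formula at the end of an arc agrees with the formula at
its start on all assignments that make the move true. -/
theorem dpll_arcs_spec {P : Type*} [DecidableEq P] (D : DpllRealization P) (sel : P → Bool)
    (leaf : PBool (LTLf P) → Node P)
    (F : PBool (LTLf P) → Move P → Option (List (Move P × Node P)))
    (hF : ∀ f ass, F f ass =
      if hV : (f.props.filter fun p => sel p).Nonempty then do
        let ℓ := D.branchingLiteral (f.props.filter fun p => sel p) f hV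
        let l₁ ← F (D.replace f ℓ) (insert ℓ ass)
        let l₂ ← F (D.replace f (ℓ.1, !ℓ.2)) (insert (ℓ.1, !ℓ.2) ass)
        return l₁ ++ l₂
      else return [(ass, leaf f)])
    (f : PBool (LTLf P)) (ass : Move P) (hass : MoveOver sel ass)
    (hdisj : ∀ ℓ ∈ ass, ℓ.1 ∉ f.props) :
    ∃ arcs, F f ass = some arcs ∧
      (∀ σ : Set P, (∀ ℓ ∈ ass, Literal.True σ ℓ) →
        ∃ arc ∈ arcs, ∀ ℓ ∈ arc.1, Literal.True σ ℓ) ∧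
      ∀ arc ∈ arcs, MoveOver sel arc.1 ∧ ass ⊆ arc.1 ∧ ∃ f', arc.2 = leaf f' ∧
        f'.vars ⊆ f.vars ∧ (∀ p ∈ f'.props, sel p = false) ∧
        ∀ C, Complementary C → (∀ ℓ ∈ arc.1, ℓ.TrueAtoms C) → (f'.Holds C ↔ f.Holds C) := by
  induction hn : f.props.card using Nat.strong_induction_on generalizing f ass with
  | _ n ih =>
  rw [hF]
  split_ifs with hV
  · set ℓ := D.branchingLiteral _ f hV with hℓ
    have hmem := D.branchingLiteral_mem _ f hV
    rw [← hℓ, Finset.mem_filter] at hmem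
    have step : ∀ b : Bool, ∃ arcs, F (D.replace f (ℓ.1, b)) (insert (ℓ.1, b) ass) = some arcs ∧
        (∀ σ : Set P, (∀ l ∈ insert (ℓ.1, b) ass, Literal.True σ l) →
          ∃ arc ∈ arcs, ∀ l ∈ arc.1, Literal.True σ l) ∧
        ∀ arc ∈ arcs, MoveOver sel arc.1 ∧ insert (ℓ.1, b) ass ⊆ arc.1 ∧ ∃ f', arc.2 = leaf f' ∧
          f'.vars ⊆ (D.replace f (ℓ.1, b)).vars ∧ (∀ p ∈ f'.props, sel p = false) ∧
          ∀ C, Complementary C → (∀ l ∈ arc.1, l.TrueAtoms C) →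
            (f'.Holds C ↔ (D.replace f (ℓ.1, b)).Holds C) := by
      intro b
      have hsub : (D.replace f (ℓ.1, b)).props ⊆ f.props.erase ℓ.1 := by
        intro p hp
        have hv := D.replace_vars f (ℓ.1, b)
        rw [mem_props_iff] at hp
        rw [Finset.mem_erase, mem_props_iff]
        rcases hp with hp | hp
        · refine ⟨?_, .inl (hv hp).1⟩
          rintro rfl
          exact (hv hp).2 (.inl rfl)
        · refine ⟨?_, .inr (hv hp).1⟩
          rintro rfl
          exact (hv hp).2 (.inr rfl)
      refine ih _ ?_ _ _ ⟨?_, ?_⟩ ?_ rfl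
      · rw [← hn]
        exact Finset.card_lt_card (hsub.trans_ssubset (Finset.erase_ssubset hmem.1))
      · intro l hl
        rcases Finset.mem_insert.1 hl with rfl | hl
        · exact hmem.2
        · exact hass.1 l hl
      · intro l hl hl'
        rcases Finset.mem_insert.1 hl with rfl | hl <;>
          rcases Finset.mem_insert.1 hl' with h | hl'
        · cases b <;> simp at h
        · exact hdisj _ hl' hmem.1
        · have : l.1 = ℓ.1 := (Prod.ext_iff.1 h).1
          exact hdisj _ hl (this ▸ hmem.1)
        · exact hass.2 l hl hl'
      · intro l hl hp
        have := Finset.mem_erase.1 (hsub hp)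
        rcases Finset.mem_insert.1 hl with rfl | hl
        · exact this.1 rfl
        · exact hdisj l hl this.2
    obtain ⟨l₁, h₁, cov₁, arc₁⟩ := step ℓ.2
    obtain ⟨l₂, h₂, cov₂, arc₂⟩ := step (!ℓ.2)
    have lift : ∀ b : Bool, ∀ arc : Move P × Node P,
        (MoveOver sel arc.1 ∧ insert (ℓ.1, b) ass ⊆ arc.1 ∧ ∃ f', arc.2 = leaf f' ∧
          f'.vars ⊆ (D.replace f (ℓ.1, b)).vars ∧ (∀ p ∈ f'.props, sel p = false) ∧
          ∀ C, Complementary C → (∀ l ∈ arc.1, l.TrueAtoms C) →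
            (f'.Holds C ↔ (D.replace f (ℓ.1, b)).Holds C)) →
        MoveOver sel arc.1 ∧ ass ⊆ arc.1 ∧ ∃ f', arc.2 = leaf f' ∧
          f'.vars ⊆ f.vars ∧ (∀ p ∈ f'.props, sel p = false) ∧
          ∀ C, Complementary C → (∀ l ∈ arc.1, l.TrueAtoms C) → (f'.Holds C ↔ f.Holds C) := by
      rintro b arc ⟨hc, hsub, f', hleaf, hvars, hprops, hholds⟩
      refine ⟨hc, (Finset.subset_insert _ _).trans hsub, f', hleaf,
        hvars.trans ((D.replace_vars f _).trans Set.sdiff_subset), hprops, fun C hC htrue => ?_⟩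
      rw [hholds C hC htrue]
      exact D.replace_holds f (ℓ.1, b) C hC (htrue _ (hsub (Finset.mem_insert_self _ _)))
    refine ⟨l₁ ++ l₂, ?_, ?_, ?_⟩
    · have h₁' : F (D.replace f ℓ) (insert ℓ ass) = some l₁ := h₁
      simp [h₁', h₂]
    · intro σ hσ
      rcases Literal.true_or_true_not σ ℓ with h | h
      · obtain ⟨arc, harc, ht⟩ := cov₁ σ (by
          intro l hl
          rcases Finset.mem_insert.1 hl with rfl | hl
          · exact h
          · exact hσ l hl)
        exact ⟨arc, List.mem_append_left _ harc, ht⟩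
      · obtain ⟨arc, harc, ht⟩ := cov₂ σ (by
          intro l hl
          rcases Finset.mem_insert.1 hl with rfl | hl
          · exact h
          · exact hσ l hl)
        exact ⟨arc, List.mem_append_right _ harc, ht⟩
    · intro arc harc
      rcases List.mem_append.1 harc with harc | harc
      · exact lift ℓ.2 arc (arc₁ arc harc)
      · exact lift (!ℓ.2) arc (arc₂ arc harc)
  · refine ⟨[(ass, leaf f)], rfl, fun σ hσ => ⟨_, List.mem_singleton_self _, hσ⟩, ?_⟩
    intro arc harc
    rw [List.mem_singleton] at harc
    subst harc
    refine ⟨hass, subset_rfl, f, rfl, subset_rfl, fun p hp => ?_, fun _ _ _ => Iff.rfl⟩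
    by_contra h
    exact hV ⟨p, Finset.mem_filter.2 ⟨hp, by simpa using h⟩⟩

section Arcs

variable {X Y : Type*}

/-- The interpretation given by the environment's and the agent's choices. -/
def joint (e : Set X) (a : Set Y) : Set (X ⊕ Y) := Sum.inl '' e ∪ Sum.inr '' a

/-- The agent's choice `a` makes all literals of the move true. -/
def Allows (act : Move (X ⊕ Y)) (a : Set Y) : Prop :=
  ∀ ℓ ∈ act, Literal.True (Sum.inr '' a : Set (X ⊕ Y)) ℓ

theorem MoveOver.true_joint_iff_allows {act : Move (X ⊕ Y)}
    (h : MoveOver (fun p : X ⊕ Y => p.isRight) act) (e : Set X) (a : Set Y) :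
    (∀ ℓ ∈ act, Literal.True (joint e a) ℓ) ↔ Allows act a := by
  refine forall₂_congr fun ℓ hℓ => ?_
  obtain ⟨y, hy⟩ := Sum.isRight_iff.1 (h.1 ℓ hℓ)
  simp [Literal.True, joint, hy]

theorem MoveOver.exists_allows {act : Move (X ⊕ Y)}
    (h : MoveOver (fun p : X ⊕ Y => p.isRight) act) : ∃ a, Allows act a := by
  refine ⟨{y | (Sum.inr y, true) ∈ act}, fun ℓ hℓ => ?_⟩
  obtain ⟨y, hy⟩ := Sum.isRight_iff.1 (h.1 ℓ hℓ)
  have := h.2 ℓ hℓ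
  rcases ℓ with ⟨p, b⟩
  obtain rfl : p = Sum.inr y := hy
  cases b <;> simp_all [Literal.True]

theorem MoveOver.exists_true_joint {resp : Move (X ⊕ Y)}
    (h : MoveOver (fun p : X ⊕ Y => p.isLeft) resp) :
    ∃ e : Set X, ∀ a : Set Y, ∀ ℓ ∈ resp, Literal.True (joint e a) ℓ := by
  refine ⟨{x | (Sum.inl x, true) ∈ resp}, fun a ℓ hℓ => ?_⟩
  obtain ⟨x, hx⟩ := Sum.isLeft_iff.1 (h.1 ℓ hℓ)
  have := h.2 ℓ hℓ
  rcases ℓ with ⟨p, b⟩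
  obtain rfl : p = Sum.inl x := hx
  cases b <;> simp_all [Literal.True, joint]

theorem MoveOver.true_joint_iff {resp : Move (X ⊕ Y)}
    (h : MoveOver (fun p : X ⊕ Y => p.isLeft) resp) (e : Set X) (a a' : Set Y) :
    (∀ ℓ ∈ resp, Literal.True (joint e a) ℓ) ↔ ∀ ℓ ∈ resp, Literal.True (joint e a') ℓ := by
  refine forall₂_congr fun ℓ hℓ => ?_
  obtain ⟨x, hx⟩ := Sum.isLeft_iff.1 (h.1 ℓ hℓ)
  simp [Literal.True, joint, hx]

theorem moveOver_empty {P : Type*} (sel : P → Bool) : MoveOver sel (∅ : Move P) :=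
  ⟨by simp, by simp⟩

open LTLf

theorem Literal.True.trueAtoms {P : Type*} {σ : Set P} {ℓ : Literal P} (h : Literal.True σ ℓ)
    (C : Set (LTLf P)) : ℓ.TrueAtoms (pullback C σ) :=
  Iff.trans h pos_mem_pullback.symm

/-- The specification of the two-step expansion of an OR-node: an OR-arc followed by an AND-arc
leads to the progression of the formula, up to equivalence of Boolean functions. -/
theorem dpllGetArcs_spec [DecidableEq X] [DecidableEq Y] (D : DpllRealization (X ⊕ Y))
    {φ ψ : LTLf (X ⊕ Y)} (hψ : IsState φ ψ) :
    ∃ arcs, dpllGetArcs D (.orNode ψ) = some arcs ∧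
      (∀ a, ∃ arc ∈ arcs, Allows arc.1 a) ∧
      ∀ arc ∈ arcs, (∃ a, Allows arc.1 a) ∧ ∃ responses, dpllGetArcs D arc.2 = some responses ∧
        (∀ r ∈ responses, IsState φ r.2.formula ∧ ∃ e, ∀ a, Allows arc.1 a →
          ∀ C, XnfHolds C r.2.formula ↔ XnfHolds C (ψ.fp (joint e a))) ∧
        ∀ e, ∃ r ∈ responses, ∀ a, Allows arc.1 a →
          ∀ C, XnfHolds C r.2.formula ↔ XnfHolds C (ψ.fp (joint e a)) := by
  obtain ⟨arcs, harcs, hcov, hspec⟩ := dpll_arcs_spec D (fun p => p.isRight)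
    (fun f => .andNode f.toFormula) (dpllGetOrArcs D) (fun f ass => by
      rw [dpllGetOrArcs]
      rfl) ψ.xnf.propositionalize ∅ (moveOver_empty _) (by simp)
  refine ⟨arcs, harcs, fun a => ?_, fun arc harc => ?_⟩
  · obtain ⟨arc, harc, ht⟩ := hcov (joint ∅ a) (by simp)
    exact ⟨arc, harc, ((hspec arc harc).1.true_joint_iff_allows ∅ a).1 ht⟩
  obtain ⟨hover, -, f, hf, hvars, hprops, hholds⟩ := hspec arc harc
  refine ⟨hover.exists_allows, ?_⟩
  have hatom : ∀ α ∈ f.vars, IsXnfAtom φ α := fun α hα =>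
    hψ.isXnfAtom α (by rw [← vars_propositionalize]; exact hvars hα)
  obtain ⟨responses, hresp, hcov', hspec'⟩ := dpll_arcs_spec D (fun p => p.isLeft)
    (fun f => .orNode f.rmNext) (dpllGetAndArcs D) (fun f ass => by
      rw [dpllGetAndArcs]
      rfl) f ∅ (moveOver_empty _) (by simp)
  have hnolit : ∀ f' : PBool (LTLf (X ⊕ Y)), f'.vars ⊆ f.vars →
      (∀ p ∈ f'.props, p.isLeft = false) → ∀ p, LTLf.pos p ∉ f'.vars ∧ LTLf.neg p ∉ f'.vars := by
    intro f' hvars' hprops' p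
    rw [← not_or, ← mem_props_iff]
    intro hp
    have h1 := hprops' p hp
    have h2 := hprops p (by
      rw [mem_props_iff] at hp ⊢
      exact hp.imp (@hvars' _) (@hvars' _))
    rcases p with x | y
    · exact nomatch h1
    · exact nomatch h2
  -- Along both arcs, the Boolean function is kept on the assignments obtained by pulling back
  -- along an instant that makes both moves true.
  have key : ∀ r ∈ responses, ∀ e a, Allows arc.1 a →
      (∀ ℓ ∈ r.1, Literal.True (joint e a) ℓ) →
      ∀ C, XnfHolds C r.2.formula ↔ XnfHolds C (ψ.fp (joint e a)) := by
    intro r hr e a ha he C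
    obtain ⟨-, -, f', hf', hvars', hprops', hholds'⟩ := hspec' r hr
    have hlit := hnolit f' hvars' hprops'
    have hC := complementary_pullback C (joint e a)
    rw [hf', Node.formula, PBool.xnfHolds_rmNext (fun α hα => hatom α (hvars' hα)) hlit C
        (joint e a), hholds' _ hC fun ℓ hℓ => (he ℓ hℓ).trueAtoms C,
      hholds _ hC fun ℓ hℓ => ((hover.true_joint_iff_allows e a).2 ha ℓ hℓ).trueAtoms C,
      xnfHolds_fp]
    rfl
  refine ⟨responses, ?_, fun r hr => ⟨?_, ?_⟩, fun e => ?_⟩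
  · rw [hf, dpllGetArcs]
    simp only [Node.formula]
    rw [PBool.toFormula_normal hatom, hresp]
  · obtain ⟨-, -, f', hf', hvars', hprops', -⟩ := hspec' r hr
    rw [hf']
    exact PBool.isState_rmNext (fun α hα => hatom α (hvars' hα)) (hnolit f' hvars' hprops')
  · obtain ⟨e, he⟩ := (hspec' r hr).1.exists_true_joint (Y := Y)
    exact ⟨e, fun a ha => key r hr e a ha (he a)⟩
  · obtain ⟨r, hr, ht⟩ := hcov' (joint e ∅) (by simp)
    exact ⟨r, hr, fun a ha => key r hr e a ha (((hspec' r hr).1.true_joint_iff e ∅ a).1 ht)⟩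

end Arcs

/-! ### Correctness of the search -/

/-- What the correctness of the search needs to know about its building blocks: the search plays
a reachability game in which the agent chooses in `A`, the environment answers in `E`, and `move`
leads from formula to formula. Equivalence of formulas is equality of their keys, of which there are
finitely many, and is a congruence of the game on the formulas in `state`. The arcs represent the
choices of the two players: every choice is covered by an arc, and every arc covers some choice. -/
structure Arena {P : Type*} (B : SearchBlocks P) (K A E : Type*) where
  key : LTLf P → K
  state : LTLf P → Prop
  move : LTLf P → A → E → LTLf P
  allows : Move P → A → Prop
  finite_range_key : (Set.range key).Finite
  equivalenceCheck_iff : ∀ ψ ψ', B.equivalenceCheck ψ ψ' = true ↔ key ψ = key ψ'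
  exists_allows_empty : ∃ a, allows ∅ a
  state_move : ∀ {ψ}, state ψ → ∀ a e, state (move ψ a e)
  isAccepting_congr : ∀ {ψ ψ'}, state ψ → state ψ' → key ψ = key ψ' →
    ψ.isAccepting = ψ'.isAccepting
  move_congr : ∀ {ψ ψ'}, state ψ → state ψ' → key ψ = key ψ' →
    ∀ a e, key (move ψ a e) = key (move ψ' a e)
  arcs : ∀ {ψ}, state ψ → ∃ arcs, B.getArcs (.orNode ψ) = some arcs ∧
    (∀ a, ∃ arc ∈ arcs, allows arc.1 a) ∧
    ∀ arc ∈ arcs, (∃ a, allows arc.1 a) ∧ ∃ responses, B.getArcs arc.2 = some responses ∧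
      (∀ r ∈ responses, state r.2.formula ∧
        ∃ e, ∀ a, allows arc.1 a → key r.2.formula = key (move ψ a e)) ∧
      ∀ e, ∃ r ∈ responses, ∀ a, allows arc.1 a → key r.2.formula = key (move ψ a e)

namespace Arena

variable {P K A E : Type*} {B : SearchBlocks P} (G : Arena B K A E)

/-- The keys of the formulas in a list. -/
def keys (L : List (LTLf P)) : Set K := G.key '' {ψ | ψ ∈ L}

theorem mem_iff (ψ : LTLf P) (L : List (LTLf P)) : B.mem ψ L = true ↔ G.key ψ ∈ G.keys L := by
  simp only [SearchBlocks.mem, List.any_eq_true, G.equivalenceCheck_iff]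
  exact exists_congr fun ψ' => and_congr_right fun _ => ⟨Eq.symm, Eq.symm⟩

theorem mem_eq_false_iff (ψ : LTLf P) (L : List (LTLf P)) :
    B.mem ψ L = false ↔ G.key ψ ∉ G.keys L := by
  rw [← G.mem_iff, Bool.not_eq_true]

variable {G} in
theorem key_mem_keys {ψ : LTLf P} {L : List (LTLf P)} (h : ψ ∈ L) : G.key ψ ∈ G.keys L :=
  ⟨ψ, h, rfl⟩

theorem keys_mono {L L' : List (LTLf P)} (h : L ⊆ L') : G.keys L ⊆ G.keys L' :=
  Set.image_mono fun _ hψ => h hψ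

@[simp] theorem keys_nil : G.keys [] = ∅ := by simp [keys]

@[simp] theorem keys_cons (ψ : LTLf P) (L : List (LTLf P)) :
    G.keys (ψ :: L) = insert (G.key ψ) (G.keys L) := by
  ext z
  simp [keys, eq_comm]

@[simp] theorem keys_append (L L' : List (LTLf P)) : G.keys (L ++ L') = G.keys L ∪ G.keys L' := by
  ext z
  simp [keys, or_and_right, exists_or]

/-- The keys of the formulas to which a strategy assigns a move. -/
def domain (S : Strategy P) : Set K := G.keys (S.map Prod.fst)

theorem lookup_isSome_iff (S : Strategy P) (ψ : LTLf P) :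
    (B.lookup S ψ).isSome = true ↔ G.key ψ ∈ G.domain S := by
  rw [domain, ← G.mem_iff]
  simp [SearchBlocks.lookup, SearchBlocks.mem, List.find?_isSome]

/-- Strategies all of whose entries lead, in one round, to an accepting formula or to earlier
entries. The order of the entries is a ranking that decreases along every play. -/
inductive Ranked : Strategy P → Prop
  | nil : Ranked []
  | snoc {S : Strategy P} {ψ : LTLf P} {act : Move P} (hS : Ranked S) (hψ : G.state ψ)
      (hnew : G.key ψ ∉ G.domain S) (hact : ∃ a, G.allows act a)
      (hsucc : ψ.isAccepting = true ∨
        ∀ a, G.allows act a → ∀ e, G.key (G.move ψ a e) ∈ G.domain S) :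
      Ranked (S ++ [(ψ, act)])

/-- `IsTrap steps T Z`: in `Z` no formula is accepting, and whatever the agent chooses, the
environment can stay in `Z` or enter `T`, along a step in `steps`. -/
def IsTrap (steps : List (LTLf P × LTLf P)) (T Z : Set K) : Prop :=
  ∀ ψ, G.state ψ → G.key ψ ∈ Z → ψ.isAccepting = false ∧
    ∀ a, ∃ e, G.key (G.move ψ a e) ∈ Z ∪ T ∧
      ∃ s ∈ steps, G.key s.1 = G.key ψ ∧ G.key s.2 = G.key (G.move ψ a e)

/-- The formulas from which the environment can prevent acceptance before `T` is entered, along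
steps in `steps`. -/
def spoiled (steps : List (LTLf P × LTLf P)) (T : Set K) : Set K :=
  {z | ∃ Z, G.IsTrap steps T Z ∧ z ∈ Z}

variable {G} {steps steps' : List (LTLf P × LTLf P)} {T T' : Set K} {ψ : LTLf P}

theorem isTrap_spoiled : G.IsTrap steps T (G.spoiled steps T) := by
  rintro ψ hψ ⟨Z, hZ, hmem⟩
  refine ⟨(hZ ψ hψ hmem).1, fun a => ?_⟩
  obtain ⟨e, he, hs⟩ := (hZ ψ hψ hmem).2 a
  exact ⟨e, he.imp (fun h => ⟨Z, hZ, h⟩) id, hs⟩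

theorem spoiled_mono (hs : steps ⊆ steps') (hT : T ⊆ T') :
    G.spoiled steps T ⊆ G.spoiled steps' T' := by
  rintro z ⟨Z, hZ, hz⟩
  refine ⟨Z, fun ψ hψ hmem => ⟨(hZ ψ hψ hmem).1, fun a => ?_⟩, hz⟩
  obtain ⟨e, he, s, hs', h⟩ := (hZ ψ hψ hmem).2 a
  exact ⟨e, he.imp id (@hT _), s, hs hs', h⟩

/-- The environment can answer the agent's choice `a` at `ψ` by a recorded step into a spoiled
formula or into `T`. -/
def Refuted (G : Arena B K A E) (steps : List (LTLf P × LTLf P)) (T : Set K) (ψ : LTLf P)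
    (a : A) : Prop :=
  ∃ e, G.key (G.move ψ a e) ∈ G.spoiled steps T ∪ T ∧
    ∃ s ∈ steps, G.key s.1 = G.key ψ ∧ G.key s.2 = G.key (G.move ψ a e)

theorem Refuted.mono {a : A} (h : G.Refuted steps T ψ a) (hs : steps ⊆ steps') (hT : T ⊆ T') :
    G.Refuted steps' T' ψ a := by
  obtain ⟨e, he, s, hs', h⟩ := h
  exact ⟨e, he.imp (@spoiled_mono _ _ _ _ _ _ _ _ _ _ hs hT _) (@hT _), s, hs hs', h⟩

/-- If all choices at `ψ` are refuted relative to `T` and `ψ` itself, then entering `ψ` does not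
help the agent, and the target `ψ` may be dropped. -/
theorem spoiled_of_refuted (hψ : G.state ψ) (hacc : ψ.isAccepting = false)
    (hT : T' ⊆ insert (G.key ψ) T) (h : ∀ a, G.Refuted steps T' ψ a) :
    insert (G.key ψ) (G.spoiled steps T') ⊆ G.spoiled steps T := by
  have hsub : ∀ z, z ∈ G.spoiled steps T' ∪ T' →
      z ∈ insert (G.key ψ) (G.spoiled steps T') ∪ T := by
    rintro z (hz | hz)
    · exact .inl (.inr hz)
    · rcases hT hz with rfl | hz
      · exact .inl (.inl rfl)
      · exact .inr hz
  refine fun z hz => ⟨_, fun ψ' hψ' hmem => ?_, hz⟩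
  rcases hmem with heq | hmem
  · refine ⟨(G.isAccepting_congr hψ' hψ heq).trans hacc, fun a => ?_⟩
    obtain ⟨e, he, s, hs, h1, h2⟩ := h a
    rw [← G.move_congr hψ' hψ heq] at he h2
    exact ⟨e, hsub _ he, s, hs, h1.trans heq.symm, h2⟩
  · refine ⟨(isTrap_spoiled ψ' hψ' hmem).1, fun a => ?_⟩
    obtain ⟨e, he, hs⟩ := (isTrap_spoiled ψ' hψ' hmem).2 a
    exact ⟨e, hsub _ he, hs⟩

/-- The formulas on the path at which a loop has been found: those on which failure tags may
depend. -/
def openKeys (G : Arena B K A E) (path loop : List (LTLf P)) : Set K := G.keys path ∩ G.keys loop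

/-- The invariant of the search. Success tags are justified by the strategy; failure tags are
justified relative to the formulas on the path at which a loop has been found. -/
structure Invariant (G : Arena B K A E) (path : List (LTLf P)) (st : SearchState P) : Prop where
  ranked : G.Ranked st.strategy
  success : G.keys st.success ⊆ G.domain st.strategy
  failure : G.keys st.failure ⊆ G.spoiled st.steps (G.openKeys path st.loop)
  state_steps : ∀ s ∈ st.steps, G.state s.1

/-- The data of the search that only grow. -/
structure Extends (st st' : SearchState P) : Prop where
  success : st.success ⊆ st'.success
  steps : st.steps ⊆ st'.steps
  loop : st.loop ⊆ st'.loop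

theorem Extends.refl (st : SearchState P) : Extends st st :=
  ⟨List.Subset.refl _, List.Subset.refl _, List.Subset.refl _⟩

theorem Extends.trans {st st' st'' : SearchState P} (h : Extends st st') (h' : Extends st' st'') :
    Extends st st'' :=
  ⟨List.Subset.trans h.success h'.success, List.Subset.trans h.steps h'.steps,
    List.Subset.trans h.loop h'.loop⟩

theorem openKeys_mono (path : List (LTLf P)) {loop loop' : List (LTLf P)} (h : loop ⊆ loop') :
    G.openKeys path loop ⊆ G.openKeys path loop' :=
  Set.inter_subset_inter_right _ (G.keys_mono h)

theorem openKeys_append_subset (path loop : List (LTLf P)) (ψ : LTLf P) :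
    G.openKeys (path ++ [ψ]) loop ⊆ insert (G.key ψ) (G.openKeys path loop) := by
  rintro z ⟨hz, hl⟩
  rw [keys_append, keys_cons, keys_nil, insert_empty_eq] at hz
  rcases hz with hz | rfl
  · exact .inr ⟨hz, hl⟩
  · exact .inl rfl

section Succeed

theorem extends_succeed (ψ : LTLf P) (act : Move P) (st : SearchState P) :
    Extends st (B.succeed ψ act st) :=
  ⟨List.subset_cons_self _ _, List.Subset.refl _, List.Subset.refl _⟩

theorem Invariant.succeed {path : List (LTLf P)} {st : SearchState P} {act : Move P}
    (h : G.Invariant path st) (hψ : G.state ψ) (hact : ∃ a, G.allows act a)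
    (hsucc : ψ.isAccepting = true ∨
      ∀ a, G.allows act a → ∀ e, G.key (G.move ψ a e) ∈ G.keys st.success) :
    G.Invariant path (B.succeed ψ act st) := by
  have hdom : G.domain (B.addToStrategy ψ act st.strategy) =
      insert (G.key ψ) (G.domain st.strategy) := by
    rw [SearchBlocks.addToStrategy]
    split_ifs with hl
    · exact (Set.insert_eq_of_mem ((G.lookup_isSome_iff _ _).1 hl)).symm
    · simp [domain, Set.union_comm]
  refine ⟨?_, ?_, h.failure, h.state_steps⟩
  · simp only [SearchBlocks.succeed, SearchBlocks.addToStrategy]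
    split_ifs with hl
    · exact h.ranked
    · exact .snoc h.ranked hψ (fun hmem => hl ((G.lookup_isSome_iff _ _).2 hmem)) hact
        (hsucc.imp id fun H a ha e => h.success (H a ha e))
  · simp only [SearchBlocks.succeed, hdom, keys_cons]
    exact Set.insert_subset_insert h.success

end Succeed

section BackProp

theorem subset_predecessors (steps : List (LTLf P × LTLf P)) (k : ℕ) (L : List (LTLf P)) :
    L ⊆ B.predecessors steps k L := by
  induction k generalizing L with
  | zero => exact List.Subset.refl _
  | succ k ih => exact List.Subset.trans (List.subset_append_left _ _) (ih _)

theorem state_of_mem_predecessors (hsteps : ∀ s ∈ steps, G.state s.1) (k : ℕ)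
    {L : List (LTLf P)} (hL : ∀ ψ ∈ L, G.state ψ) :
    ∀ ψ ∈ B.predecessors steps k L, G.state ψ := by
  induction k generalizing L with
  | zero => exact hL
  | succ k ih =>
    refine ih fun ψ hψ => ?_
    rcases List.mem_append.1 hψ with hψ | hψ
    · exact hL ψ hψ
    · obtain ⟨s, hs, rfl⟩ := List.mem_map.1 hψ
      exact hsteps s (List.mem_filter.1 hs).1

theorem predecessors_eq_self {L : List (LTLf P)}
    (h : steps.filter (fun e => B.mem e.2 L && !B.mem e.1 L) = []) (k : ℕ) :
    B.predecessors steps k L = L := by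
  induction k with
  | zero => rfl
  | succ k ih => rw [SearchBlocks.predecessors, h, List.map_nil, List.append_nil, ih]

theorem countP_lt_countP {α : Type*} {p q : α → Bool} {l : List α} {x : α}
    (h : ∀ y ∈ l, p y = true → q y = true) (hx : x ∈ l) (hp : p x = false) (hq : q x = true) :
    l.countP p < l.countP q := by
  have heq : l.countP p = (l.filter q).countP p := by
    rw [List.countP_filter]
    refine List.countP_congr fun y hy => ?_
    rw [Bool.and_eq_true_iff]
    exact ⟨fun hpy => ⟨hpy, h y hy hpy⟩, And.left⟩
  rw [heq, List.countP_eq_length_filter (p := q), List.countP_lt_length_iff]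
  exact ⟨x, List.mem_filter.2 ⟨hx, hq⟩, hp⟩

/-- As many rounds as there are steps with a source outside `L` suffice to close `L` under
predecessors, since each round that changes anything makes one of these sources a member. -/
theorem predecessors_closed (k : ℕ) (L : List (LTLf P))
    (hk : (steps.countP fun s => !B.mem s.1 L) ≤ k) :
    ∀ s ∈ steps, G.key s.2 ∈ G.keys (B.predecessors steps k L) →
      G.key s.1 ∈ G.keys (B.predecessors steps k L) := by
  induction k generalizing L with
  | zero =>
    intro s hs _
    have := List.countP_eq_zero.1 (Nat.le_zero.1 hk) s hs
    rw [← G.mem_iff]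
    simpa [SearchBlocks.predecessors] using this
  | succ k ih =>
    by_cases hex : ∃ s ∈ steps, (B.mem s.2 L && !B.mem s.1 L) = true
    · refine ih _ (Nat.le_of_lt_succ (lt_of_lt_of_le ?_ hk))
      obtain ⟨s, hs, hnew⟩ := hex
      set new := (steps.filter fun e => B.mem e.2 L && !B.mem e.1 L).map Prod.fst
      have hmono : ∀ e ∈ steps, (!B.mem e.1 (L ++ new)) = true →
          (!B.mem e.1 L) = true := by
        intro e _ he
        rw [Bool.not_eq_true', G.mem_eq_false_iff] at he ⊢
        exact fun h => he (G.keys_mono (List.subset_append_left _ _) h)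
      have hin : G.key s.1 ∈ G.keys (L ++ new) := key_mem_keys <| List.mem_append_right _ <|
        List.mem_map.2 ⟨s, List.mem_filter.2 ⟨hs, hnew⟩, rfl⟩
      refine countP_lt_countP hmono hs ?_ (Bool.and_eq_true_iff.1 hnew).2
      rw [(G.mem_iff _ _).2 hin]
      rfl
    · have hnil : steps.filter (fun e => B.mem e.2 L && !B.mem e.1 L) = [] :=
        List.filter_eq_nil_iff.2 fun s hs h => hex ⟨s, hs, h⟩
      rw [predecessors_eq_self hnil]
      intro s hs hmem
      by_contra hnot
      refine hex ⟨s, hs, ?_⟩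
      rw [(G.mem_iff _ _).2 hmem, (G.mem_eq_false_iff _ _).2 hnot]
      rfl

theorem exists_findSuccessMove (G : Arena B K A E) (st : SearchState P)
    (arcs : List (Move P × Node P))
    (harcs : ∀ arc ∈ arcs, ∃ responses, B.getArcs arc.2 = some responses) :
    ∃ o, B.findSuccessMove st arcs = some o ∧ ∀ act, o = some act →
      ∃ arc ∈ arcs, arc.1 = act ∧ ∃ responses, B.getArcs arc.2 = some responses ∧
        ∀ r ∈ responses, G.key r.2.formula ∈ G.keys st.success := by
  induction arcs with
  | nil => exact ⟨none, rfl, by simp⟩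
  | cons arc arcs ih =>
    obtain ⟨responses, hresp⟩ := harcs arc List.mem_cons_self
    obtain ⟨o, ho, hspec⟩ := ih fun arc' h => harcs arc' (List.mem_cons_of_mem _ h)
    rw [SearchBlocks.findSuccessMove]
    simp only [hresp, Option.bind_eq_bind, Option.bind_some]
    split_ifs with hall
    · refine ⟨_, rfl, fun act hact => ⟨arc, List.mem_cons_self, Option.some.inj hact, responses,
        hresp, fun r hr => ?_⟩⟩
      rw [← G.mem_iff]
      exact List.all_eq_true.1 hall r hr
    · refine ⟨o, ho, fun act hact => ?_⟩
      obtain ⟨arc', h, rest⟩ := hspec act hact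
      exact ⟨arc', List.mem_cons_of_mem _ h, rest⟩

/-- A formula with an arc all of whose responses are tagged success may be tagged success. -/
theorem move_mem_success {arc : Move P × Node P} {responses : List (Move P × Node P)}
    {S : List (LTLf P)}
    (hcov : ∀ e, ∃ r ∈ responses, ∀ a, G.allows arc.1 a →
      G.key r.2.formula = G.key (G.move ψ a e))
    (h : ∀ r ∈ responses, G.key r.2.formula ∈ G.keys S) :
    ∀ a, G.allows arc.1 a → ∀ e, G.key (G.move ψ a e) ∈ G.keys S := by
  intro a ha e
  obtain ⟨r, hr, heq⟩ := hcov e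
  rw [← heq a ha]
  exact h r hr

theorem Invariant.propagateOnce {path : List (LTLf P)} (L : List (LTLf P))
    (hL : ∀ ψ ∈ L, G.state ψ) {st : SearchState P} (h : G.Invariant path st) :
    ∃ st', B.propagateOnce L st = some st' ∧ G.Invariant path st' ∧ Extends st st' := by
  induction L generalizing st with
  | nil => exact ⟨st, rfl, h, .refl st⟩
  | cons ψ L ih =>
    have ih := @ih fun ψ' h => hL ψ' (List.mem_cons_of_mem _ h)
    have hψ := hL ψ List.mem_cons_self
    rw [SearchBlocks.propagateOnce]
    split_ifs with hmem
    · exact ih h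
    · obtain ⟨arcs, harcs, -, hspec⟩ := G.arcs hψ
      obtain ⟨o, ho, hospec⟩ := exists_findSuccessMove G st arcs
        fun arc harc => (hspec arc harc).2.imp fun _ h => h.1
      simp only [harcs, ho, Option.bind_eq_bind, Option.bind_some]
      cases o with
      | none => exact ih h
      | some act =>
        obtain ⟨arc, harc, rfl, responses, hresp, hsucc⟩ := hospec act rfl
        obtain ⟨hact, responses', hresp', -, hcov⟩ := hspec arc harc
        obtain rfl : responses' = responses := Option.some.inj (hresp'.symm.trans hresp)
        obtain ⟨st', hst', hinv, hext⟩ :=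
          ih (h.succeed hψ hact (.inr (move_mem_success hcov hsucc)))
        exact ⟨st', hst', hinv, (extends_succeed ψ arc.1 st).trans hext⟩

theorem Invariant.propagate {path : List (LTLf P)} (L : List (LTLf P))
    (hL : ∀ ψ ∈ L, G.state ψ) (k : ℕ) {st : SearchState P} (h : G.Invariant path st) :
    ∃ st', B.propagate L k st = some st' ∧ G.Invariant path st' ∧ Extends st st' := by
  induction k generalizing st with
  | zero => exact ⟨st, rfl, h, .refl st⟩
  | succ k ih =>
    obtain ⟨st', hst', hinv, hext⟩ := h.propagateOnce L hL
    obtain ⟨st'', hst'', hinv', hext'⟩ := ih hinv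
    refine ⟨st'', ?_, hinv', hext.trans hext'⟩
    simp only [SearchBlocks.propagate, hst', Option.bind_eq_bind, Option.bind_some, hst'']

/-- `BackProp` restores the invariant for the path without its last formula `ψ`: the failure tags
that it keeps belong to formulas from which no recorded steps lead to `ψ`, so that these tags do not
depend on `ψ`. -/
theorem Invariant.backProp {path : List (LTLf P)} {st : SearchState P}
    (h : G.Invariant (path ++ [ψ]) st) (hψ : G.state ψ) :
    ∃ st', B.backProp ψ st = some st' ∧ G.Invariant path st' ∧ Extends st st' := by
  set L := B.ancestors st ψ
  have hL : ∀ ψ' ∈ L, G.state ψ' :=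
    state_of_mem_predecessors h.state_steps _ (by simpa using hψ)
  have hψL : G.key ψ ∈ G.keys L :=
    key_mem_keys (subset_predecessors _ _ _ (List.mem_singleton_self ψ))
  have hclosed : ∀ s ∈ st.steps, G.key s.2 ∈ G.keys L → G.key s.1 ∈ G.keys L :=
    predecessors_closed _ _ List.countP_le_length
  -- A recorded step into `L` starts in `L`, so outside `L` the trap is left only into `path`.
  have htrap : G.IsTrap st.steps (G.openKeys path st.loop)
      (G.spoiled st.steps (G.openKeys (path ++ [ψ]) st.loop) \ G.keys L) := by
    rintro ψ' hψ' ⟨hmem, hnot⟩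
    refine ⟨(isTrap_spoiled ψ' hψ' hmem).1, fun a => ?_⟩
    obtain ⟨e, he, s, hs, h1, h2⟩ := (isTrap_spoiled ψ' hψ' hmem).2 a
    have hout : G.key (G.move ψ' a e) ∉ G.keys L := by
      rw [← h2]
      exact fun hin => hnot (h1 ▸ hclosed s hs hin)
    refine ⟨e, ?_, s, hs, h1, h2⟩
    rcases he with he | he
    · exact .inl ⟨he, hout⟩
    · rcases openKeys_append_subset path st.loop ψ he with heq | he
      · exact absurd (heq ▸ hψL) hout
      · exact .inr he
  have hinv : G.Invariant path
      { st with failure := st.failure.filter fun m => !B.mem m L } := by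
    refine ⟨h.ranked, h.success, ?_, h.state_steps⟩
    rintro _ ⟨n, hn, rfl⟩
    obtain ⟨hn, hnL⟩ := List.mem_filter.1 hn
    rw [Bool.not_eq_true', G.mem_eq_false_iff] at hnL
    exact ⟨_, htrap, h.failure (key_mem_keys hn), hnL⟩
  obtain ⟨st', hst', hinv', hext⟩ := hinv.propagate L hL L.length
  exact ⟨st', hst', hinv', ⟨hext.success, hext.steps, hext.loop⟩⟩

end BackProp

section Search

/-- The specification of `Search` on a given path. -/
def SearchSpec (G : Arena B K A E) (path : List (LTLf P)) : Prop :=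
  ∀ (ψ : LTLf P) (st : SearchState P), G.state ψ → G.Invariant path st →
    ∃ b st', B.search ψ path st = some (b, st') ∧ Extends st st' ∧ G.Invariant path st' ∧
      (b = true → G.key ψ ∈ G.keys st'.success) ∧
      (b = false → G.key ψ ∈
        G.spoiled st'.steps (G.openKeys path st'.loop) ∪ G.openKeys path st'.loop)

variable {path : List (LTLf P)} {st : SearchState P}

theorem Invariant.addStep (h : G.Invariant path st) (hψ : G.state ψ) (ψ' : LTLf P) :
    G.Invariant path { st with steps := (ψ, ψ') :: st.steps } :=
  ⟨h.ranked, h.success,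
    h.failure.trans (spoiled_mono (List.subset_cons_self _ _) subset_rfl),
    fun s hs => (List.mem_cons.1 hs).elim (fun heq => heq ▸ hψ) (h.state_steps s)⟩

theorem searchAnd_spec (hspec : G.SearchSpec (path ++ [ψ])) (hψ : G.state ψ)
    (responses : List (Move P × Node P)) (hstate : ∀ r ∈ responses, G.state r.2.formula)
    (h : G.Invariant (path ++ [ψ]) st) :
    ∃ b st', B.searchAnd ψ path responses st = some (b, st') ∧ Extends st st' ∧
      G.Invariant (path ++ [ψ]) st' ∧
      (b = true → ∀ r ∈ responses, G.key r.2.formula ∈ G.keys st'.success) ∧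
      (b = false → ∃ r ∈ responses, G.key r.2.formula ∈
          G.spoiled st'.steps (G.openKeys (path ++ [ψ]) st'.loop) ∪
            G.openKeys (path ++ [ψ]) st'.loop ∧ (ψ, r.2.formula) ∈ st'.steps) := by
  induction responses generalizing st with
  | nil =>
    rw [SearchBlocks.searchAnd]
    exact ⟨true, st, rfl, .refl st, h, by simp, by simp⟩
  | cons r responses ih =>
    rw [SearchBlocks.searchAnd]
    obtain ⟨b, st₁, hs, hext, hinv, htrue, hfalse⟩ :=
      hspec r.2.formula _ (hstate r List.mem_cons_self) (h.addStep hψ r.2.formula)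
    have hext' : Extends st st₁ :=
      ⟨hext.success, List.Subset.trans (List.subset_cons_self _ _) hext.steps, hext.loop⟩
    simp only [hs, Option.bind_eq_bind, Option.bind_some]
    cases b with
    | false =>
      exact ⟨false, st₁, rfl, hext', hinv, by simp, fun _ => ⟨r, List.mem_cons_self, hfalse rfl,
        hext.steps List.mem_cons_self⟩⟩
    | true =>
      obtain ⟨b, st₂, hs₂, hext₂, hinv₂, htrue₂, hfalse₂⟩ :=
        ih (fun r' h => hstate r' (List.mem_cons_of_mem _ h)) hinv
      refine ⟨b, st₂, hs₂, hext'.trans hext₂, hinv₂, fun hb r' hr' => ?_, fun hb => ?_⟩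
      · rcases List.mem_cons.1 hr' with rfl | hr'
        · exact G.keys_mono hext₂.success (htrue rfl)
        · exact htrue₂ hb r' hr'
      · obtain ⟨r', hr', rest⟩ := hfalse₂ hb
        exact ⟨r', List.mem_cons_of_mem _ hr', rest⟩

theorem Invariant.of_notMem_loop (h : G.Invariant (path ++ [ψ]) st)
    (hloop : G.key ψ ∉ G.keys st.loop) : G.Invariant path st := by
  refine ⟨h.ranked, h.success, h.failure.trans (spoiled_mono (List.Subset.refl _) ?_),
    h.state_steps⟩
  intro z hz
  rcases openKeys_append_subset path st.loop ψ hz with rfl | hz'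
  · exact absurd hz.2 hloop
  · exact hz'

/-- The outer loop: `arcs` are the arcs that have not been explored yet, and all choices of the
agent that they do not cover have been refuted. -/
theorem searchOr_spec (hspec : G.SearchSpec (path ++ [ψ])) (hψ : G.state ψ)
    (hacc : ψ.isAccepting = false) (arcs : List (Move P × Node P))
    (harcs : ∀ arc ∈ arcs, (∃ a, G.allows arc.1 a) ∧
      ∃ responses, B.getArcs arc.2 = some responses ∧
        (∀ r ∈ responses, G.state r.2.formula ∧
          ∃ e, ∀ a, G.allows arc.1 a → G.key r.2.formula = G.key (G.move ψ a e)) ∧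
        ∀ e, ∃ r ∈ responses, ∀ a, G.allows arc.1 a →
          G.key r.2.formula = G.key (G.move ψ a e))
    (h : G.Invariant (path ++ [ψ]) st)
    (hdone : ∀ a, (∃ arc ∈ arcs, G.allows arc.1 a) ∨
      G.Refuted st.steps (G.openKeys (path ++ [ψ]) st.loop) ψ a) :
    ∃ b st', B.searchOr ψ path arcs st = some (b, st') ∧ Extends st st' ∧
      G.Invariant path st' ∧ (b = true → G.key ψ ∈ G.keys st'.success) ∧
      (b = false → G.key ψ ∈ G.spoiled st'.steps (G.openKeys path st'.loop)) := by
  induction arcs generalizing st with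
  | nil =>
    rw [SearchBlocks.searchOr]
    have hsub := spoiled_of_refuted hψ hacc (openKeys_append_subset path st.loop ψ)
      fun a => (hdone a).resolve_left (by simp)
    refine ⟨false, _, rfl, ⟨List.Subset.refl _, List.Subset.refl _, List.Subset.refl _⟩,
      ⟨h.ranked, h.success, ?_, h.state_steps⟩, by simp, fun _ => hsub (.inl rfl)⟩
    rw [keys_cons]
    exact (Set.insert_subset_insert h.failure).trans hsub
  | cons arc arcs ih =>
    rw [SearchBlocks.searchOr]
    obtain ⟨hact, responses, hresp, hstate, hcov⟩ := harcs arc List.mem_cons_self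
    obtain ⟨b, st₁, hs, hext, hinv, htrue, hfalse⟩ :=
      searchAnd_spec hspec hψ responses (fun r hr => (hstate r hr).1) h
    simp only [hresp, hs, Option.bind_eq_bind, Option.bind_some]
    cases b with
    | false =>
      obtain ⟨r, hr, hmem, hstep⟩ := hfalse rfl
      obtain ⟨e, he⟩ := (hstate r hr).2
      obtain ⟨b, st₂, hs₂, hext₂, rest⟩ :=
        ih (fun arc' h => harcs arc' (List.mem_cons_of_mem _ h)) hinv fun a => by
          rcases hdone a with ⟨arc', harc', ha⟩ | hr
          · rcases List.mem_cons.1 harc' with rfl | harc'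
            · exact .inr ⟨e, he a ha ▸ hmem, _, hstep, rfl, he a ha⟩
            · exact .inl ⟨arc', harc', ha⟩
          · exact .inr (hr.mono hext.steps (openKeys_mono _ hext.loop))
      exact ⟨b, st₂, hs₂, hext.trans hext₂, rest⟩
    | true =>
      have hinv₂ := hinv.succeed hψ hact (.inr (move_mem_success hcov (htrue rfl)))
      have hext₂ := hext.trans (extends_succeed (B := B) ψ arc.1 st₁)
      have hmem : G.key ψ ∈ G.keys (B.succeed ψ arc.1 st₁).success :=
        key_mem_keys List.mem_cons_self
      simp only [if_true]
      split_ifs with hloop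
      · obtain ⟨st₃, hs₃, hinv₃, hext₃⟩ := hinv₂.backProp hψ
        rw [hs₃]
        exact ⟨true, st₃, rfl, hext₂.trans hext₃, hinv₃,
          fun _ => G.keys_mono hext₃.success hmem, by simp⟩
      · rw [Bool.not_eq_true, G.mem_eq_false_iff] at hloop
        exact ⟨true, _, rfl, hext₂, hinv₂.of_notMem_loop hloop, fun _ => hmem, by simp⟩

/-- `Search` terminates and meets its specification on every path, by induction on the number of
keys that do not occur on the path. -/
theorem searchSpec (G : Arena B K A E) (path : List (LTLf P)) : G.SearchSpec path := by
  induction hn : (Set.range G.key \ G.keys path).ncard using Nat.strong_induction_on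
    generalizing path with
  | _ n ih =>
  intro ψ st hψ h
  rw [SearchBlocks.search]
  split_ifs with hsucc hfail hpath hacc
  · exact ⟨true, st, rfl, .refl st, h, fun _ => (G.mem_iff _ _).1 hsucc, by simp⟩
  · exact ⟨false, st, rfl, .refl st, h, by simp,
      fun _ => .inl (h.failure ((G.mem_iff _ _).1 hfail))⟩
  · refine ⟨false, _, rfl, ⟨List.Subset.refl _, List.Subset.refl _, List.subset_cons_self _ _⟩,
      ⟨h.ranked, h.success, h.failure.trans (spoiled_mono (List.Subset.refl _)
        (openKeys_mono _ (List.subset_cons_self _ _))), h.state_steps⟩, by simp, fun _ => .inr ?_⟩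
    exact ⟨(G.mem_iff _ _).1 hpath, key_mem_keys List.mem_cons_self⟩
  · exact ⟨true, _, rfl, extends_succeed ψ ∅ st, h.succeed hψ G.exists_allows_empty (.inl hacc),
      fun _ => key_mem_keys List.mem_cons_self, by simp⟩
  · have hlt : (Set.range G.key \ G.keys (path ++ [ψ])).ncard < n := by
      rw [← hn]
      refine Set.ncard_lt_ncard ?_ (G.finite_range_key.subset Set.sdiff_subset)
      rw [Bool.not_eq_true, G.mem_eq_false_iff] at hpath
      refine ⟨Set.sdiff_subset_sdiff_right (G.keys_mono (List.subset_append_left _ _)),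
        fun hsub => ?_⟩
      exact (hsub ⟨⟨ψ, rfl⟩, hpath⟩).2 (key_mem_keys (by simp))
    obtain ⟨arcs, harcs, hcov, hspec⟩ := G.arcs hψ
    have hT : G.openKeys path st.loop ⊆ G.openKeys (path ++ [ψ]) st.loop :=
      Set.inter_subset_inter_left _ (G.keys_mono (List.subset_append_left _ _))
    obtain ⟨b, st', hs, hext, hinv, htrue, hfalse⟩ :=
      searchOr_spec (ih _ hlt _ rfl) hψ (by simpa using hacc) arcs hspec
        ⟨h.ranked, h.success, h.failure.trans (spoiled_mono (List.Subset.refl _) hT),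
          h.state_steps⟩ fun a => .inl (hcov a)
    simp only [harcs, Option.bind_eq_bind, Option.bind_some]
    exact ⟨b, st', hs, hext, hinv, htrue, fun hb => .inl (hfalse hb)⟩

end Search

end Arena

/-! ### The synthesis game -/

section Game

open LTLf

variable {X Y : Type*}

theorem playTrace_append_singleton (g : List (Set X) → Set Y) (h : List (Set X)) (e : Set X) :
    playTrace g (h ++ [e]) = playTrace g h ++ [joint e (g h)] := by
  rw [playTrace, List.mapIdx_concat, List.take_left' rfl, playTrace]
  congr 1
  refine List.mapIdx_eq_mapIdx_iff.2 fun i hi => ?_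
  rw [List.take_append_of_le_length hi.le]

theorem fpTrace_playTrace_append_singleton (φ : LTLf (X ⊕ Y)) (g : List (Set X) → Set Y)
    (h : List (Set X)) (e : Set X) :
    fpTrace φ (playTrace g (h ++ [e])) = fp (joint e (g h)) (fpTrace φ (playTrace g h)) := by
  rw [playTrace_append_singleton, fpTrace_append_singleton]

/-- Every strategy with satisfiable moves is implemented by the function that tracks the current
formula and plays a completion of the move that the strategy assigns to it. -/
theorem exists_implements (B : SearchBlocks (X ⊕ Y)) (φ : LTLf (X ⊕ Y)) {S : Strategy (X ⊕ Y)}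
    (h : ∀ e ∈ S, ∃ a, Allows e.2 a) : ∃ g, Implements B φ S g := by
  have hchoice : ∀ ψ, ∃ a, ∀ act, B.lookup S ψ = some act → Allows act a := by
    intro ψ
    cases hl : B.lookup S ψ with
    | none => exact ⟨∅, by simp⟩
    | some act =>
      obtain ⟨e, he, rfl⟩ := Option.map_eq_some_iff.1 hl
      obtain ⟨a, ha⟩ := h e (List.mem_of_find?_eq_some he)
      exact ⟨a, fun act hact => Option.some.inj hact ▸ ha⟩
  choose c hc using hchoice
  let current : List (Set X) → LTLf (X ⊕ Y) :=
    fun h => h.foldl (fun ψ e => fp (joint e (c ψ)) ψ) φ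
  have hcurrent : ∀ h, fpTrace φ (playTrace (fun h => c (current h)) h) = current h := by
    intro h
    induction h using List.reverseRecOn with
    | nil => rfl
    | append_singleton h e ih =>
      rw [fpTrace_playTrace_append_singleton, ih]
      simp [current]
  refine ⟨fun h => c (current h), fun h act hact => ?_⟩
  rw [hcurrent] at hact
  exact hc _ act hact

variable [DecidableEq X] [DecidableEq Y]

theorem bddBasedEqCheck_iff {P : Type*} [DecidableEq P] (ord : List (LTLf P)) (ψ ψ' : LTLf P) :
    bddBasedEqCheck ord ψ ψ' = true ↔
      bddRepresentation ord ψ.xnf.propositionalize =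
        bddRepresentation ord ψ'.xnf.propositionalize :=
  decide_eq_true_iff

theorem xnfHolds_congr_of_bdd {P : Type*} [DecidableEq P] {φ ψ ψ' : LTLf P}
    {ord : List (LTLf P)} (hord : ∀ α ∈ bddVars φ, α ∈ ord) (hψ : IsState φ ψ)
    (hψ' : IsState φ ψ')
    (h : bddRepresentation ord ψ.xnf.propositionalize =
      bddRepresentation ord ψ'.xnf.propositionalize) (C : Set (LTLf P)) :
    XnfHolds C ψ ↔ XnfHolds C ψ' := by
  have hvars : ∀ ψ, IsState φ ψ → ∀ α ∈ ψ.xnf.propositionalize.vars, α ∈ ord := by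
    intro ψ hψ α hα
    rw [vars_propositionalize] at hα
    exact hord α (pa_xnf_subset_bddVars hψ hα)
  rw [XnfHolds, XnfHolds, ← holds_bddRepresentation C ord _ (hvars ψ hψ), h,
    holds_bddRepresentation C ord _ (hvars ψ' hψ')]

/-- The synthesis game on the state formulas for `φ`, with the decision diagram as key: one round is
progression through the instant that the players choose together. -/
noncomputable def synthesisArena (φ : LTLf (X ⊕ Y)) (ord : List (LTLf (X ⊕ Y)))
    (hord : ∀ α ∈ bddVars φ, α ∈ ord) (D : DpllRealization (X ⊕ Y)) :
    Arena (bddDpllBlocks ord D) (BDD (LTLf (X ⊕ Y))) (Set Y) (Set X) where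
  key ψ := bddRepresentation ord ψ.xnf.propositionalize
  state := IsState φ
  move ψ a e := fp (joint e a) ψ
  allows := Allows
  finite_range_key := (finite_range_bddRepresentation ord).subset (by
    rintro _ ⟨ψ, rfl⟩
    exact ⟨_, rfl⟩)
  equivalenceCheck_iff := bddBasedEqCheck_iff ord
  exists_allows_empty := ⟨∅, by simp [Allows]⟩
  state_move h a e := h.fp _
  isAccepting_congr hψ hψ' h := by
    rw [Bool.eq_iff_iff, isAccepting_iff_xnfHolds, isAccepting_iff_xnfHolds]
    exact xnfHolds_congr_of_bdd hord hψ hψ' h _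
  move_congr hψ hψ' h a e := bddRepresentation_congr ord fun C => by
    have := xnfHolds_congr_of_bdd hord hψ hψ' h (pullback C (joint e a))
    rwa [← xnfHolds_fp, ← xnfHolds_fp] at this
  arcs hψ := by
    obtain ⟨arcs, harcs, hcov, hspec⟩ := dpllGetArcs_spec D hψ
    refine ⟨arcs, harcs, hcov, fun arc harc => ⟨(hspec arc harc).1, ?_⟩⟩
    obtain ⟨responses, hresp, hsound, hcompl⟩ := (hspec arc harc).2
    refine ⟨responses, hresp, fun r hr => ⟨(hsound r hr).1, ?_⟩, fun e => ?_⟩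
    · obtain ⟨e, he⟩ := (hsound r hr).2
      exact ⟨e, fun a ha => bddRepresentation_congr ord (he a ha)⟩
    · obtain ⟨r, hr, h⟩ := hcompl e
      exact ⟨r, hr, fun a ha => bddRepresentation_congr ord (h a ha)⟩

theorem lookup_append {P : Type*} (B : SearchBlocks P) (S S' : Strategy P) (ψ : LTLf P) :
    B.lookup (S ++ S') ψ = (B.lookup S ψ).or (B.lookup S' ψ) := by
  simp only [SearchBlocks.lookup, List.find?_append]
  cases S.find? fun e => B.equivalenceCheck ψ e.1 <;> rfl

variable {φ : LTLf (X ⊕ Y)} {ord : List (LTLf (X ⊕ Y))} {hord : ∀ α ∈ bddVars φ, α ∈ ord}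
  {D : DpllRealization (X ⊕ Y)}

theorem Arena.Ranked.exists_allows {S : Strategy (X ⊕ Y)}
    (h : (synthesisArena φ ord hord D).Ranked S) : ∀ e ∈ S, ∃ a, Allows e.2 a := by
  induction h with
  | nil => simp
  | snoc _ _ _ hact _ ih =>
    intro e he
    rcases List.mem_append.1 he with he | he
    · exact ih e he
    · rw [List.mem_singleton.1 he]
      exact hact

/-- Once a play against an implementation of a strategy reaches the domain of a ranked initial
segment of the strategy, it reaches an accepting formula. -/
theorem Arena.Ranked.exists_isAccepting {S : Strategy (X ⊕ Y)}
    (h : (synthesisArena φ ord hord D).Ranked S) (S' : Strategy (X ⊕ Y))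
    {g : List (Set X) → Set Y} (hg : Implements (bddDpllBlocks ord D) φ (S ++ S') g)
    (env : ℕ → Set X) (k : ℕ)
    (hk : (synthesisArena φ ord hord D).key
        (fpTrace φ (playTrace g ((List.range k).map env))) ∈
      (synthesisArena φ ord hord D).domain S) :
    ∃ k', (fpTrace φ (playTrace g ((List.range k').map env))).isAccepting = true := by
  induction h generalizing S' k with
  | nil => simp [domain] at hk
  | @snoc S ψ act hS hψ hnew hact hsucc ih =>
    have hg' : Implements (bddDpllBlocks ord D) φ (S ++ ((ψ, act) :: S')) g := by
      simpa using hg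
    by_cases hkS : (synthesisArena φ ord hord D).key
        (fpTrace φ (playTrace g ((List.range k).map env))) ∈
      (synthesisArena φ ord hord D).domain S
    · exact ih _ hg' k hkS
    set θ := fpTrace φ (playTrace g ((List.range k).map env)) with hθ
    have hstate : IsState φ θ := (isState_self φ).fpTrace _
    have heq : (synthesisArena φ ord hord D).key θ = (synthesisArena φ ord hord D).key ψ := by
      simpa [domain] using (show _ ∨ _ by simpa [domain] using hk).resolve_right hkS
    rcases hsucc with hacc | hsucc
    · exact ⟨k, ((synthesisArena φ ord hord D).isAccepting_congr hstate hψ heq).trans hacc⟩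
    · have hlookup : (bddDpllBlocks ord D).lookup (S ++ ((ψ, act) :: S')) θ = some act := by
        have hnone : (bddDpllBlocks ord D).lookup S θ = none := by
          rw [← Option.not_isSome_iff_eq_none,
            (synthesisArena φ ord hord D).lookup_isSome_iff]
          exact hkS
        rw [lookup_append, hnone, Option.none_or]
        simp [SearchBlocks.lookup,
          ((synthesisArena φ ord hord D).equivalenceCheck_iff θ ψ).2 heq]
      refine ih _ hg' (k + 1) ?_
      rw [List.range_succ, List.map_append, List.map_singleton,
        fpTrace_playTrace_append_singleton, ← hθ]
      have := hsucc (g ((List.range k).map env)) (hg' _ act hlookup) (env k)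
      rwa [← (synthesisArena φ ord hord D).move_congr hstate hψ heq] at this

/-- If the environment can prevent acceptance from `φ` forever, then no agent function wins. -/
theorem not_exists_wins {steps : List (LTLf (X ⊕ Y) × LTLf (X ⊕ Y))}
    (h : (synthesisArena φ ord hord D).key φ ∈ (synthesisArena φ ord hord D).spoiled steps ∅) :
    ¬ ∃ g, Wins φ g := by
  rintro ⟨g, hg⟩
  set G := synthesisArena φ ord hord D
  have hanswer : ∀ h : List (Set X), ∃ e,
      G.key (fpTrace φ (playTrace g h)) ∈ G.spoiled steps ∅ →
        G.key (fpTrace φ (playTrace g (h ++ [e]))) ∈ G.spoiled steps ∅ := by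
    intro h
    by_cases hmem : G.key (fpTrace φ (playTrace g h)) ∈ G.spoiled steps ∅
    · obtain ⟨e, he, -⟩ :=
        (Arena.isTrap_spoiled _ ((isState_self φ).fpTrace _) hmem).2 (g h)
      refine ⟨e, fun _ => ?_⟩
      rw [fpTrace_playTrace_append_singleton]
      exact he.resolve_right (Set.notMem_empty _)
    · exact ⟨∅, fun h => absurd h hmem⟩
  choose answer hans using hanswer
  let history : ℕ → List (Set X) := fun k => Nat.rec [] (fun _ h => h ++ [answer h]) k
  have hhist : ∀ k, (List.range k).map (fun i => answer (history i)) = history k := by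
    intro k
    induction k with
    | zero => rfl
    | succ k ih => rw [List.range_succ, List.map_append, ih]; rfl
  have hmem : ∀ k, G.key (fpTrace φ (playTrace g (history k))) ∈ G.spoiled steps ∅ := by
    intro k
    induction k with
    | zero => exact h
    | succ k ih => exact hans _ ih
  obtain ⟨k, hk⟩ := hg fun i => answer (history i)
  rw [sat_iff_isAccepting_fpTrace, hhist] at hk
  exact absurd hk (by simp [(Arena.isTrap_spoiled _ ((isState_self φ).fpTrace _) (hmem k)).1])

end Game

theorem WinsNonempty.wins {X Y : Type*} {φ : LTLf (X ⊕ Y)} {g : List (Set X) → Set Y}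
    (h : WinsNonempty φ g) : Wins φ g := fun env =>
  (h env).elim fun k hk => ⟨k + 1, hk⟩

theorem Wins.winsNonempty {X Y : Type*} {φ : LTLf (X ⊕ Y)} {g : List (Set X) → Set Y}
    (h : Wins φ g) (hφ : ¬ LTLf.Sat [] φ) : WinsNonempty φ g := by
  intro env
  obtain ⟨k, hk⟩ := h env
  cases k with
  | zero => exact absurd hk hφ
  | succ k => exact ⟨k, hk⟩

theorem Answer.Correct.winsNonempty {X Y : Type*} {B : SearchBlocks (X ⊕ Y)}
    {φ : LTLf (X ⊕ Y)} {a : Answer (X ⊕ Y)} (h : a.Correct B φ (Wins φ))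
    (hφ : ¬ LTLf.Sat [] φ) : a.Correct B φ (WinsNonempty φ) := by
  cases a with
  | unrealizable => exact fun ⟨g, hg⟩ => h ⟨g, hg.wins⟩
  | strategy S => exact ⟨h.1, fun g hg => (h.2 g hg).winsNonempty hφ⟩

theorem mainTheorem1 {X Y : Type*} [DecidableEq X] [DecidableEq Y]
    (φ : LTLf (X ⊕ Y)) (ord : List (LTLf (X ⊕ Y))) (hnodup : ord.Nodup)
    (hord : ∀ α ∈ bddVars φ, α ∈ ord) (D : DpllRealization (X ⊕ Y)) :
    ∃ a : Answer (X ⊕ Y),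
      synthesis (bddDpllBlocks ord D) φ = some a ∧
      a.Correct (bddDpllBlocks ord D) φ (Wins φ) ∧
      (¬ LTLf.Sat [] φ → a.Correct (bddDpllBlocks ord D) φ (WinsNonempty φ)) := by
  suffices h : ∃ a, synthesis (bddDpllBlocks ord D) φ = some a ∧
      a.Correct (bddDpllBlocks ord D) φ (Wins φ) from
    h.imp fun a ha => ⟨ha.1, ha.2, ha.2.winsNonempty⟩
  rw [synthesis]
  split_ifs with hacc
  · refine ⟨_, rfl, exists_implements _ _ ?_, fun g _ env => ⟨0, (LTLf.holds_nil_iff φ).2 hacc⟩⟩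
    simp [SearchBlocks.addToStrategy, SearchBlocks.lookup, Allows]
  · set G := synthesisArena φ ord hord D
    have hinv : G.Invariant [] ⟨[], [], [], [], []⟩ := ⟨.nil, by simp, by simp, by simp⟩
    obtain ⟨b, st, hs, -, hinv', htrue, hfalse⟩ :=
      G.searchSpec [] φ _ (LTLf.isState_self φ) hinv
    simp only [hs, Option.bind_eq_bind, Option.bind_some]
    cases b with
    | true =>
      refine ⟨_, rfl, exists_implements _ _ hinv'.ranked.exists_allows, fun g hg env => ?_⟩
      obtain ⟨k, hk⟩ := hinv'.ranked.exists_isAccepting [] (by simpa using hg) env 0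
        (hinv'.success (htrue rfl))
      exact ⟨k, (LTLf.sat_iff_isAccepting_fpTrace _ _).2 hk⟩
    | false =>
      refine ⟨_, rfl, not_exists_wins (hord := hord) (D := D) (steps := st.steps) ?_⟩
      have hopen : G.openKeys [] st.loop = ∅ := by simp [Arena.openKeys]
      have := hfalse rfl
      rwa [hopen, Set.union_empty] at this
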